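/- **Conventions.** Hilbert spaces are complex and $d\in\mathbb N\cup\{\infty\}$. A $d$-tuple $T=(T_j)$ of bounded operators on a Hilbert space $H$ is a *row contraction* if $(x_j)\mapsto\sum_j T_jx_j$ is a contraction $\bigoplus_{j}H\to H$. Its defect operator is $D_T=(\delta_{ij}I-T_i^*T_j)^{1/2}$ on $\bigoplus_j H$, its *defect space* is $\mathcal D_T=\overline{\operatorname{ran}}\,D_T$, and its *defect* is the Hilbert space dimension of $\mathcal D_T$. For a word $\alpha=\alpha_1\cdots\alpha_m$ put $T_\alpha=T_{\alpha_1}\cdots T_{\alpha_m}$, with $T_\emptyset=I$. Let $\Gamma$ be the full Fock space over $\mathbb C^d$ (over $\ell^2$ if $d=\infty$), with orthonormal basis $e_\alpha$ indexed by words and left creation operators $L_je_\alpha=e_{j\alpha}$. The minimal isometric dilation $V^T$ of a row contraction $T$ acts on $H\oplus(\Gamma\otimes\mathcal D_T)$ by $V^T_j(h\oplus\xi)=T_jh\oplus\big(e_\emptyset\otimes D_T(0,\dots,h,\dots,0)+(L_j\otimes I)\xi\big)$, with $h$ in the $j$-th place. A *contractive multi-analytic operator* is an operator $M:\Gamma\otimes\mathcal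 D\to\Gamma\otimes\mathcal L$ with $\|M\|\le1$ that intertwines the operators $L_j\otimes I$ for all $j$. It is determined by its *symbol* $\Theta:\mathcal D\to\Gamma\otimes\mathcal L$, $\Theta\delta=M(e_\emptyset\otimes\delta)$. Symbols $\Theta:\mathcal D\to\Gamma\otimes\mathcal L$ and $\Theta':\mathcal D'\to\Gamma\otimes\mathcal L$ are *equivalent* if $\Theta'\circ v=\Theta$ for some unitary $v:\mathcal D\to\mathcal D'$. Let $C$ be a row contraction on $H_C$. A *lifting* of $C$ is a $d$-tuple $E$ on a Hilbert space $H_E=H_C\oplus H_A$ with $E_j=\begin{pmatrix}C_j&0\\B_j&A_j\end{pmatrix}$. It is *contractive* if $E$ is a row contraction, and *minimal* if $\overline{\operatorname{span}}\{E_\alpha x: x\in H_C,\ \alpha\text{ a word}\}=H_E$. Liftings $E,E'$ of $C$ are *unitarily equivalent* if some unitary $H_E\to H_{E'}$ intertwines $E$ and $E'$ and is the identity on $H_C$. *The map $\mathcal E$.* Let $M:\Gamma\otimes\mathcal D\to\Gamma\otimes\mathcal D_C$ be a contractive multi-analytic operator and $\Delta=(I-M^*M)^{1/2}$. On $H_\Theta=(\Gamma\otimes\mathcal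 D_C)\oplus\overline{\Delta(\Gamma\otimes\mathcal D)}$ let $V_j(\eta\oplus\Delta\xi)=(L_j\otimes I)\eta\oplus\Delta(L_j\otimes I)\xi$, and put $H_A=H_\Theta\ominus\{M\xi\oplus\Delta\xi:\xi\in\Gamma\otimes\mathcal D\}$. Let $\hat V$ be the row isometry on $H_C\oplus H_\Theta$ that restricts to $V$ on $H_\Theta$ and to $V^C$ on $H_C\oplus(\Gamma\otimes\mathcal D_C)$. Then $\mathcal E(M)$ is the compression of $\hat V$ to $H_C\oplus H_A$. *The map $\mathcal M$.* Let $E$ be a contractive lifting of $C$ with minimal isometric dilation $V^E$ on $H_E\oplus(\Gamma\otimes\mathcal D_E)$. Let $\mathcal L_C=\overline{\operatorname{span}}\{H_C,V^E_jH_C : j\}\ominus H_C$, identified with $\mathcal D_C$ through $D_C(\xi_i)\mapsto\sum_i(V^E_i-C_i)\xi_i$. Correspondingly $\bigoplus_\alpha V^E_\alpha\mathcal L_C$ is identified with $\Gamma\otimes\mathcal D_C$. Then $\mathcal M(E):\Gamma\otimes\mathcal D_E\to\Gamma\otimes\mathcal D_C$ is the restriction to $\Gamma\otimes\mathcal D_E$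 of the orthogonal projection onto $\bigoplus_\alpha V^E_\alpha\mathcal L_C$. **Theorem.** Let $C$ be a row contraction on a Hilbert space $H_C$. Then $\mathcal E$ maps contractive multi-analytic operators $\Gamma\otimes\mathcal D\to\Gamma\otimes\mathcal D_C$ ($\mathcal D$ any Hilbert space) to contractive liftings of $C$, and $\mathcal M$ maps contractive liftings of $C$ to contractive multi-analytic operators into $\Gamma\otimes\mathcal D_C$. Moreover $\mathcal M$ maps minimal contractive liftings to operators with injective symbols, $\mathcal E$ maps operators with injective symbols to minimal contractive liftings, and the two maps induce mutually inverse bijections between the unitary equivalence classes of minimal contractive liftings $E$ of $C$ and the equivalence classes of injective symbols $\Theta:\mathcal D\to\Gamma\otimes\mathcal D_C$ of contractive multi-analytic operators. If the class of $E$ corresponds to the class of $\Theta:\mathcal D\to\Gamma\otimes\mathcal D_C$, then $\dim\mathcal D$ is equal to the defect of $E$. -/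

import Mathlib

open scoped InnerProductSpace

universe u

noncomputable section

namespace RowLifting

/-! ### Direct sums of Hilbert spaces -/

/-- The Hilbert space direct sum `A ⊕ B`. -/
abbrev HSum (A B : Type*) : Type _ := WithLp 2 (A × B)

section General

variable {X A B K F : Type*}
variable [NormedAddCommGroup X] [InnerProductSpace ℂ X]
variable [NormedAddCommGroup A] [InnerProductSpace ℂ A]
variable [NormedAddCommGroup B] [InnerProductSpace ℂ B]
variable [NormedAddCommGroup K] [InnerProductSpace ℂ K]
variable [NormedAddCommGroup F] [InnerProductSpace ℂ F]

/-- The operator `x ↦ f x ⊕ g x`. -/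
def pair (f : X →L[ℂ] A) (g : X →L[ℂ] B) : X →L[ℂ] HSum A B :=
  (WithLp.prodContinuousLinearEquiv 2 ℂ A B).symm.toContinuousLinearMap ∘L f.prod g

@[simp] theorem pair_apply (f : X →L[ℂ] A) (g : X →L[ℂ] B) (x : X) :
    pair f g x = WithLp.toLp 2 (f x, g x) := rfl

/-- The coordinate projection `A ⊕ B → A`. -/
abbrev fst : HSum A B →L[ℂ] A := WithLp.fstL 2 ℂ A B

/-- The coordinate projection `A ⊕ B → B`. -/
abbrev snd : HSum A B →L[ℂ] B := WithLp.sndL 2 ℂ A B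

/-- The embedding `A → A ⊕ B`, `a ↦ a ⊕ 0`. -/
def inl : A →L[ℂ] HSum A B := pair (ContinuousLinearMap.id ℂ A) 0

/-- The embedding `B → A ⊕ B`, `b ↦ 0 ⊕ b`. -/
def inr : B →L[ℂ] HSum A B := pair 0 (ContinuousLinearMap.id ℂ B)

/-- The Hilbert space direct sum `⨁_{k ∈ κ} K` of copies of `K`. -/
abbrev Copies (κ K : Type*) [NormedAddCommGroup K] : Type _ := lp (fun _ : κ => K) 2

open Classical in
/-- The embedding of `K` as the `k`-th summand of `⨁_κ K`. -/
def single {κ : Type*} (k : κ) : K →L[ℂ] Copies κ K :=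
  lp.singleContinuousLinearMap ℂ (fun _ : κ => K) 2 k

/-- The inclusion of the algebraic direct sum of copies of `K` into the Hilbert space direct sum. -/
def ofFinsupp (κ K : Type*) [NormedAddCommGroup K] [InnerProductSpace ℂ K] :
    (κ →₀ K) →ₗ[ℂ] Copies κ K :=
  Finsupp.lsum ℂ fun k => (single (K := K) k).toLinearMap

/-- The row operator `⨁_κ K → F`, `(x_k) ↦ ∑ T_k x_k`, of a family `T_k : K → F`: the continuous
extension to `⨁_κ K` of this map on finitely supported families (on which it has to be bounded). -/
def row {κ : Type*} [CompleteSpace F] (T : κ → K →L[ℂ] F) : Copies κ K →L[ℂ] F :=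
  (Finsupp.lsum ℂ fun k => (T k).toLinearMap : (κ →₀ K) →ₗ[ℂ] F).extendOfNorm (ofFinsupp κ K)

/-- The defect operator `(I - T* T)^{1/2}` of a contraction `T`. -/
def defectOp [CompleteSpace A] [CompleteSpace B] (T : A →L[ℂ] B) : A →L[ℂ] A :=
  CFC.sqrt (1 - (ContinuousLinearMap.adjoint T) ∘L T)

/-- The closure of the range of the defect operator `(I - T* T)^{1/2}`. -/
abbrev defectRange [CompleteSpace A] [CompleteSpace B] (T : A →L[ℂ] B) : Submodule ℂ A :=
  (LinearMap.range (defectOp T).toLinearMap).topologicalClosure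

/-- The defect operator `(I - T* T)^{1/2}`, as an operator into the closure of its range. -/
def toDefect [CompleteSpace A] [CompleteSpace B] (T : A →L[ℂ] B) : A →L[ℂ] defectRange T :=
  (defectOp T).codRestrict (defectRange T)
    fun x => Submodule.le_topologicalClosure _ (LinearMap.mem_range_self _ x)

/-- The Hilbert space dimension: the cardinality of a Hilbert basis. -/
def hilbertDim (K : Type u) [NormedAddCommGroup K] [InnerProductSpace ℂ K] : Cardinal.{u} :=
  sInf {c | ∃ (κ : Type u) (_ : HilbertBasis κ ℂ K), Cardinal.mk κ = c}

end General

/-! ### Row contractions and the minimal isometric dilation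

A `d`-tuple of operators is a family indexed by a type `ι` with `d` elements; `ι` may be infinite. -/

section Row

variable {ι : Type} {H : Type u} [NormedAddCommGroup H] [InnerProductSpace ℂ H]

/-- `T` is a row contraction: `(x_i) ↦ ∑ T_i x_i` is a contraction from `⨁_i H` to `H`. -/
def IsRowContraction (T : ι → H →L[ℂ] H) : Prop :=
  ∀ x : ι →₀ H, ‖x.sum fun i h => T i h‖ ^ 2 ≤ x.sum fun _ h => ‖h‖ ^ 2

/-- The operator `T_α = T_{α₁} ⋯ T_{α_m}` of a word `α = α₁ ⋯ α_m`. -/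
def word (T : ι → H →L[ℂ] H) (α : List ι) : H →L[ℂ] H := (α.map T).prod

variable [CompleteSpace H]

/-- The defect space `𝓓_T` of a row contraction: the closure of the range of the defect operator
`D_T = (δ_{ij} I - T_i* T_j)^{1/2}` in `⨁_i H`. Its Hilbert space dimension is the defect of `T`. -/
abbrev DefectSpace (T : ι → H →L[ℂ] H) : Submodule ℂ (Copies ι H) := defectRange (row T)

/-- The defect operator as a map `D_T : ⨁_i H → 𝓓_T`. -/
def toDefectSpace (T : ι → H →L[ℂ] H) : Copies ι H →L[ℂ] DefectSpace T := toDefect (row T)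

end Row

/-- The Hilbert space `Γ ⊗ 𝓛` where `Γ` is the full Fock space over `ℂ^d`. As `Γ` has the orthonormal
basis `e_α = e_{α₁} ⊗ ⋯ ⊗ e_{α_m}` indexed by the words `α`, it is the space of square summable
families `ξ = ∑ e_α ⊗ ξ_α` in `𝓛`. -/
abbrev Fock (ι : Type) (𝓛 : Type u) [NormedAddCommGroup 𝓛] : Type u := Copies (List ι) 𝓛

section Fock

variable {ι : Type} {𝓛 : Type u} [NormedAddCommGroup 𝓛] [InnerProductSpace ℂ 𝓛]

/-- The embedding `δ ↦ e_∅ ⊗ δ` of `𝓛` into `Γ ⊗ 𝓛`. -/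
def vacuum (ι : Type) (𝓛 : Type u) [NormedAddCommGroup 𝓛] [InnerProductSpace ℂ 𝓛] :
    𝓛 →L[ℂ] Fock ι 𝓛 := single []

variable [CompleteSpace 𝓛]

/-- The creation operator `L_j ⊗ I` on `Γ ⊗ 𝓛`, which maps `e_α ⊗ δ` to `e_{jα} ⊗ δ`. -/
def creation (j : ι) : Fock ι 𝓛 →L[ℂ] Fock ι 𝓛 :=
  row fun α : List ι => single (K := 𝓛) (j :: α)

end Fock

/-- The canonical minimal isometric dilation `V^T` of a row contraction `T`, on `H ⊕ (Γ ⊗ 𝓓_T)`: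
`V_j (h ⊕ ξ) = T_j h ⊕ (e_∅ ⊗ D_T (0, …, h, …, 0) + (L_j ⊗ I) ξ)`, with `h` in the `j`-th place. -/
def dilation {ι : Type} {H : Type u} [NormedAddCommGroup H] [InnerProductSpace ℂ H]
    [CompleteSpace H] (T : ι → H →L[ℂ] H) (j : ι) :
    HSum H (Fock ι (DefectSpace T)) →L[ℂ] HSum H (Fock ι (DefectSpace T)) :=
  pair (T j ∘L fst)
    (vacuum ι (DefectSpace T) ∘L toDefectSpace T ∘L single j ∘L fst + creation j ∘L snd)

/-! ### Multi-analytic operators -/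

/-- A Hilbert space `𝓓` together with an operator `M : Γ ⊗ 𝓓 → Γ ⊗ 𝓛`. -/
structure FockOperator (ι : Type) (𝓛 : Type u) [NormedAddCommGroup 𝓛] [InnerProductSpace ℂ 𝓛] where
  /-- the space `𝓓` -/
  D : Type u
  [nacg : NormedAddCommGroup D]
  [ips : InnerProductSpace ℂ D]
  [complete : CompleteSpace D]
  /-- the operator -/
  op : Fock ι D →L[ℂ] Fock ι 𝓛

attribute [instance] FockOperator.nacg FockOperator.ips FockOperator.complete

namespace FockOperator

variable {ι : Type} {𝓛 : Type u} [NormedAddCommGroup 𝓛] [InnerProductSpace ℂ 𝓛]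

/-- The symbol `Θ : 𝓓 → Γ ⊗ 𝓛`, `Θ δ = M (e_∅ ⊗ δ)`. -/
def symbol (M : FockOperator ι 𝓛) : M.D →L[ℂ] Fock ι 𝓛 := M.op ∘L vacuum ι M.D

/-- `M` is a contractive multi-analytic operator: it intertwines the operators `L_j ⊗ I` and
`‖M‖ ≤ 1`. -/
def IsContractiveMultiAnalytic [CompleteSpace 𝓛] (M : FockOperator ι 𝓛) : Prop :=
  (∀ j : ι, M.op ∘L creation j = creation j ∘L M.op) ∧ ‖M.op‖ ≤ 1

/-- Equivalence: there is a unitary `v : 𝓓 → 𝓓'` with `Θ' ∘ v = Θ`. -/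
def Equivalent (M M' : FockOperator ι 𝓛) : Prop :=
  ∃ v : M.D ≃ₗᵢ[ℂ] M'.D, ∀ δ, M'.symbol (v δ) = M.symbol δ

end FockOperator

/-- The contractive multi-analytic operators into `Γ ⊗ 𝓛` with injective symbol. (A multi-analytic
operator is determined by its symbol.) -/
def InjectiveSymbol (ι : Type) (𝓛 : Type u) [NormedAddCommGroup 𝓛] [InnerProductSpace ℂ 𝓛]
    [CompleteSpace 𝓛] : Type (u + 1) :=
  {M : FockOperator ι 𝓛 // M.IsContractiveMultiAnalytic ∧ Function.Injective M.symbol}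

/-- Equivalence of injective symbols. -/
def symbolSetoid (ι : Type) (𝓛 : Type u) [NormedAddCommGroup 𝓛] [InnerProductSpace ℂ 𝓛]
    [CompleteSpace 𝓛] : Setoid (InjectiveSymbol ι 𝓛) where
  r M M' := M.1.Equivalent M'.1
  iseqv :=
    { refl := fun M => ⟨LinearIsometryEquiv.refl ℂ M.1.D, fun _ => rfl⟩
      symm := fun ⟨v, hv⟩ => ⟨v.symm, fun δ => by rw [← hv, v.apply_symm_apply]⟩
      trans := fun ⟨v, hv⟩ ⟨w, hw⟩ => ⟨v.trans w, fun δ => (hw (v δ)).trans (hv δ)⟩ }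

/-! ### Liftings -/

section Lifting

variable {ι : Type} {H : Type u} [NormedAddCommGroup H] [InnerProductSpace ℂ H]

/-- A lifting of `C`: a tuple `E` on a Hilbert space `H ⊕ H_A` of the block form
`E_j (h ⊕ a) = C_j h ⊕ (B_j h + A_j a)`. -/
structure Lifting (C : ι → H →L[ℂ] H) where
  /-- the space `H_A` -/
  HA : Type u
  [nacg : NormedAddCommGroup HA]
  [ips : InnerProductSpace ℂ HA]
  [complete : CompleteSpace HA]
  /-- the tuple `E` -/
  op : ι → HSum H HA →L[ℂ] HSum H HA
  fst_op : ∀ j x, (op j x).fst = C j x.fst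

attribute [instance] Lifting.nacg Lifting.ips Lifting.complete

namespace Lifting

variable {C : ι → H →L[ℂ] H}

/-- The lifting is contractive: `E` is a row contraction. -/
def IsContractive (E : Lifting C) : Prop := IsRowContraction E.op

/-- The lifting is minimal: the vectors `E_α h`, with `h ∈ H` and `α` a word, have dense span. -/
def IsMinimal (E : Lifting C) : Prop :=
  (Submodule.span ℂ
    {y | ∃ (α : List ι) (h : H), y = word E.op α (inl h)}).topologicalClosure = ⊤

/-- Unitary equivalence of liftings: there is a unitary which intertwines `E` and `E'` and restricts
to the identity on `H`. -/
def Equivalent (E E' : Lifting C) : Prop :=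
  ∃ w : HSum H E.HA ≃ₗᵢ[ℂ] HSum H E'.HA,
    (∀ j x, w (E.op j x) = E'.op j (w x)) ∧ ∀ h : H, w (inl h) = inl h

end Lifting

/-- The minimal contractive liftings of `C`. -/
def MinimalContractiveLifting (C : ι → H →L[ℂ] H) : Type (u + 1) :=
  {E : Lifting C // E.IsContractive ∧ E.IsMinimal}

/-- Unitary equivalence of minimal contractive liftings. -/
def liftingSetoid (C : ι → H →L[ℂ] H) : Setoid (MinimalContractiveLifting C) where
  r E E' := E.1.Equivalent E'.1
  iseqv :=
    { refl := fun E => ⟨LinearIsometryEquiv.refl ℂ _, fun _ _ => rfl, fun _ => rfl⟩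
      symm := fun ⟨v, hv, hv'⟩ => ⟨v.symm,
        fun j x => by rw [v.symm_apply_eq, hv, v.apply_symm_apply],
        fun h => by rw [v.symm_apply_eq, hv']⟩
      trans := fun ⟨v, hv, hv'⟩ ⟨w, hw, hw'⟩ => ⟨v.trans w,
        fun j x => by simp [hv, hw],
        fun h => by simp [hv', hw']⟩ }

end Lifting

/-! ### The functional model and the map `𝓔` -/

section FunctionalModel

variable {ι : Type} {𝓛 : Type u} [NormedAddCommGroup 𝓛] [InnerProductSpace ℂ 𝓛] [CompleteSpace 𝓛]

/-- The model space `H_Θ = (Γ ⊗ 𝓛) ⊕ closure (Δ (Γ ⊗ 𝓓))`, where `Δ = (I - M* M)^{1/2}`. -/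
abbrev ModelSpace (M : FockOperator ι 𝓛) : Type u := HSum (Fock ι 𝓛) (defectRange M.op)

/-- The isometry `W : Γ ⊗ 𝓓 → H_Θ`, `W ξ = M ξ ⊕ Δ ξ`. -/
def modelIsometry (M : FockOperator ι 𝓛) : Fock ι M.D →L[ℂ] ModelSpace M :=
  pair M.op (toDefect M.op)

/-- The operator on `closure (Δ (Γ ⊗ 𝓓))` determined by `Δ ξ ↦ Δ (L_j ⊗ I) ξ`. -/
def residualShift (M : FockOperator ι 𝓛) (j : ι) : defectRange M.op →L[ℂ] defectRange M.op :=
  (toDefect M.op ∘L creation j).toLinearMap.extendOfNorm (toDefect M.op).toLinearMap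

/-- The row isometry `V_j (η ⊕ Δ ξ) = (L_j ⊗ I) η ⊕ Δ (L_j ⊗ I) ξ` on the model space. -/
def modelShift (M : FockOperator ι 𝓛) (j : ι) : ModelSpace M →L[ℂ] ModelSpace M :=
  pair (creation j ∘L fst) (residualShift M j ∘L snd)

/-- `H_A = H_Θ ⊖ W (Γ ⊗ 𝓓)`. -/
abbrev modelHA (M : FockOperator ι 𝓛) : Submodule ℂ (ModelSpace M) :=
  (LinearMap.range (modelIsometry M).toLinearMap)ᗮ

instance (M : FockOperator ι 𝓛) : CompleteSpace (ModelSpace M) := inferInstance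

instance (M : FockOperator ι 𝓛) : CompleteSpace (modelHA M) :=
  Submodule.instOrthogonalCompleteSpace _

instance (M : FockOperator ι 𝓛) : (modelHA M).HasOrthogonalProjection :=
  Submodule.HasOrthogonalProjection.ofCompleteSpace _

end FunctionalModel

section Maps

variable {ι : Type} {H : Type u} [NormedAddCommGroup H] [InnerProductSpace ℂ H] [CompleteSpace H]

/-- The row isometry on `H ⊕ H_Θ` which restricts to `V` on `H_Θ` and to the minimal isometric
dilation `V^C` on `H ⊕ (Γ ⊗ 𝓓_C)`. -/
def bigShift (C : ι → H →L[ℂ] H) (M : FockOperator ι (DefectSpace C)) (j : ι) :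
    HSum H (ModelSpace M) →L[ℂ] HSum H (ModelSpace M) :=
  pair (C j ∘L fst)
    (inl ∘L vacuum ι (DefectSpace C) ∘L toDefectSpace C ∘L single j ∘L fst
      + modelShift M j ∘L snd)

/-- The lifting `𝓔(M)` of `C`: the compression of `bigShift C M` to `H_E = H ⊕ H_A`. -/
def mapE (C : ι → H →L[ℂ] H) (M : FockOperator ι (DefectSpace C)) : Lifting C where
  HA := modelHA M
  op j := pair fst ((modelHA M).orthogonalProjectionOnto ∘L snd) ∘L bigShift C M j
    ∘L pair fst ((modelHA M).subtypeL ∘L snd)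
  fst_op j x := by simp [bigShift]

/-- The canonical isometry from `𝓓_C` onto the wandering subspace
`𝓛_C = closure (span {H, V^E (⨁_i H)}) ⊖ H` of `V^E`, determined by
`D_C (ξ_i) ↦ ∑ (V^E_i - C_i) ξ_i`. -/
def wanderingIsometry (C : ι → H →L[ℂ] H) (E : Lifting C) :
    DefectSpace C →L[ℂ] HSum (HSum H E.HA) (Fock ι (DefectSpace E.op)) :=
  (row fun i : ι => (dilation E.op i ∘L inl ∘L inl - inl ∘L inl ∘L C i :
      H →L[ℂ] HSum (HSum H E.HA) (Fock ι (DefectSpace E.op)))).toLinearMap.extendOfNorm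
    (toDefectSpace C).toLinearMap

/-- The canonical isometry from `Γ ⊗ 𝓓_C` onto `⨁_α V^E_α 𝓛_C`, which maps `e_α ⊗ δ` to
`V^E_α u δ` where `u : 𝓓_C → 𝓛_C` is the canonical unitary. -/
def shiftIsometry (C : ι → H →L[ℂ] H) (E : Lifting C) :
    Fock ι (DefectSpace C) →L[ℂ] HSum (HSum H E.HA) (Fock ι (DefectSpace E.op)) :=
  row fun α : List ι => word (dilation E.op) α ∘L wanderingIsometry C E

/-- The operator `𝓜(E) : Γ ⊗ 𝓓_E → Γ ⊗ 𝓓_C`: the orthogonal projection of the dilation space onto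
`⨁_α V^E_α 𝓛_C`, restricted to `Γ ⊗ 𝓓_E = ⨁_α V^E_α 𝓛_E`, where `⨁_α V^E_α 𝓛_C` is identified
with `Γ ⊗ 𝓓_C` by the canonical isometry. (If `U` is an isometry, then `U U*` is the orthogonal
projection onto its range and `U*` is this projection followed by the inverse of `U`.) -/
def mapM (C : ι → H →L[ℂ] H) (E : Lifting C) : FockOperator ι (DefectSpace C) where
  D := DefectSpace E.op
  op := ContinuousLinearMap.adjoint (shiftIsometry C E) ∘L inr

end Maps

end RowLifting

end

/-!
Contractive liftings `E` of a row contraction `C` and contractive multi-analytic operators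
`M : Γ ⊗ 𝓓 → Γ ⊗ 𝓓_C` are compared through one relation, `Models E M d`. It asks for operators `d_j`
from the space of `E` into `𝓓`, with ranges that together are total and with the Gram matrix
`⟨d_i x, d_j y⟩ = δ_ij ⟨x, y⟩ - ⟨E_i x, E_j y⟩`, so that `𝓓` is a copy of the defect space of `E`, and
with `⟨d_j E_β h, δ⟩ = ⟨V^C_j V^C_β h, M (e_∅ ⊗ δ)⟩` for `h` in the space `H` of `C`.

The relation rigidly ties the two sides together, by comparison of Gram matrices of total families:

* For a given `E` the Gram matrix of the vectors `d_j x` is prescribed, and the components of the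
  vectors `V^C_α h` in `Γ ⊗ 𝓓_C` are total (`isTotal_orbit_cons`). So the symbol of `M` is determined
  up to a unitary of `𝓓` (`Models.operator_equivalent`).
* For a given `M` the vectors `d_j E_β h` are determined, and then the inner products
  `⟨E_α h, E_β k⟩` by recursion on the words. If `E` is minimal, these determine `E` up to a unitary
  which fixes `H` (`Models.lifting_equivalent`).
* If `E` is minimal, the vectors `d_j E_β h` are total, so the symbol is injective
  (`Models.injective_symbol`).

It remains to see that both constructions produce related pairs. For `𝓜(E)` take
`d_j x = D_E (0, …, x, …, 0)`; the canonical isometry onto `⨁_α V^E_α 𝓛_C` carries the Fock space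
component of `V^C_α h` to `V^E_α h - C_α h` (`shiftIsometry_orbit`), which gives the last condition
(`models_mapM`). For `𝓔(M)`, the row isometry on `H ⊕ H_Θ` is a dilation of `𝓔(M)` on whose
complement it is the shift `W (Γ ⊗ 𝓓)`, and `d_j x` is read off from
`V_j x - 𝓔(M)_j x = W (e_∅ ⊗ d_j x)` (`IsShiftDilation.shift_S_eq`). Injectivity of the symbol is what
makes the ranges of the `d_j` total (`models_mapE`). All parts of the correspondence, including that
it is well defined on classes, follow formally.
-/

noncomputable section

namespace RowLifting

open ContinuousLinearMap (adjoint)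

/-! ### Total families and Gram matrices -/

section Total

variable {κ X Y : Type*}
variable [NormedAddCommGroup X] [InnerProductSpace ℂ X]
variable [NormedAddCommGroup Y] [InnerProductSpace ℂ Y]

/-- A family of vectors is total if only the zero vector is orthogonal to all its members; in a
Hilbert space this says that its linear span is dense (`isTotal_iff_span_dense`). -/
def IsTotal (v : κ → X) : Prop := ∀ x, (∀ k, ⟪v k, x⟫_ℂ = 0) → x = 0

theorem isTotal_iff_span_dense [CompleteSpace X] (v : κ → X) :
    IsTotal v ↔ (Submodule.span ℂ (Set.range v)).topologicalClosure = ⊤ := by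
  rw [Submodule.topologicalClosure_eq_top_iff, Submodule.eq_bot_iff]
  refine forall_congr' fun x => imp_congr_left ?_
  rw [Submodule.mem_orthogonal]
  refine ⟨fun h u hu => ?_, fun h k => h _ (Submodule.subset_span ⟨k, rfl⟩)⟩
  induction hu using Submodule.span_induction with
  | mem u hu => obtain ⟨k, rfl⟩ := hu; exact h k
  | zero => exact inner_zero_left _
  | add a b _ _ ha hb => rw [inner_add_left, ha, hb, add_zero]
  | smul c a _ ha => rw [inner_smul_left, ha, mul_zero]

theorem IsTotal.ext {v : κ → X} (hv : IsTotal v) {x y : X}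
    (h : ∀ k, ⟪v k, x⟫_ℂ = ⟪v k, y⟫_ℂ) : x = y :=
  sub_eq_zero.1 (hv _ fun k => by rw [inner_sub_right, h, sub_self])

theorem IsTotal.denseRange_linearCombination [CompleteSpace X] {v : κ → X} (hv : IsTotal v) :
    DenseRange (Finsupp.linearCombination ℂ v) := by
  rw [isTotal_iff_span_dense, ← Finsupp.range_linearCombination] at hv
  exact (Submodule.dense_iff_topologicalClosure_eq_top).2 hv

/-- Two bounded operators which agree on a total family are equal. -/
theorem IsTotal.clm_ext [CompleteSpace X] {v : κ → X} (hv : IsTotal v) {S T : X →L[ℂ] Y}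
    (h : ∀ k, S (v k) = T (v k)) : S = T := by
  ext x
  induction x using hv.denseRange_linearCombination.induction_on with
  | hp => exact isClosed_eq (by fun_prop) (by fun_prop)
  | ih a => simp only [Finsupp.linearCombination_apply, Finsupp.sum, map_sum, map_smul, h]

theorem norm_eq_of_inner_self_eq {x : X} {y : Y} (h : ⟪x, x⟫_ℂ = ⟪y, y⟫_ℂ) : ‖x‖ = ‖y‖ := by
  rw [inner_self_eq_norm_sq_to_K, inner_self_eq_norm_sq_to_K] at h
  have h' : ‖x‖ ^ 2 = ‖y‖ ^ 2 := by exact_mod_cast h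
  exact (sq_eq_sq₀ (norm_nonneg _) (norm_nonneg _)).1 h'

/-- Sesquilinear identities can be checked on a total family. -/
theorem IsTotal.inner_ext {Z : Type*} [NormedAddCommGroup Z] [InnerProductSpace ℂ Z]
    [CompleteSpace X] [CompleteSpace Y] [CompleteSpace Z] {v : κ → X} (hv : IsTotal v)
    {S T : X →L[ℂ] Y} {S' T' : X →L[ℂ] Z}
    (h : ∀ k l, ⟪S (v k), T (v l)⟫_ℂ = ⟪S' (v k), T' (v l)⟫_ℂ) (x y : X) :
    ⟪S x, T y⟫_ℂ = ⟪S' x, T' y⟫_ℂ := by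
  have key : adjoint S ∘L T = adjoint S' ∘L T' := hv.clm_ext fun l => hv.ext fun k => by
    simp only [ContinuousLinearMap.comp_apply, ContinuousLinearMap.adjoint_inner_right, h]
  have := congrArg (fun z => ⟪x, z⟫_ℂ) (DFunLike.congr_fun key y)
  simpa [ContinuousLinearMap.adjoint_inner_right] using this

/-- If `f` and `e` have the same Gram matrix and `e` has dense range, then `e x ↦ f x` extends to
an isometry. -/
theorem extendOfNorm_of_inner_eq {Z : Type*} [NormedAddCommGroup Z] [InnerProductSpace ℂ Z]
    [CompleteSpace Y] {f : X →L[ℂ] Y} {e : X →L[ℂ] Z} (he : DenseRange e)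
    (h : ∀ x y, ⟪f x, f y⟫_ℂ = ⟪e x, e y⟫_ℂ) :
    (∀ x, f.toLinearMap.extendOfNorm e.toLinearMap (e x) = f x) ∧
      ∀ a b, ⟪f.toLinearMap.extendOfNorm e.toLinearMap a,
        f.toLinearMap.extendOfNorm e.toLinearMap b⟫_ℂ = ⟪a, b⟫_ℂ := by
  have h₁ (x : X) : f.toLinearMap.extendOfNorm e.toLinearMap (e x) = f x :=
    LinearMap.extendOfNorm_eq (f := f.toLinearMap) (e := e.toLinearMap) he
      ⟨1, fun x => by
        rw [one_mul]
        exact (norm_eq_of_inner_self_eq (h x x)).le⟩ x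
  refine ⟨h₁, fun a b => ?_⟩
  induction a using he.induction_on with
  | hp => exact isClosed_eq (by fun_prop) (by fun_prop)
  | ih x =>
    induction b using he.induction_on with
    | hp => exact isClosed_eq (by fun_prop) (by fun_prop)
    | ih y => rw [h₁, h₁, h]

theorem inner_linearCombination_congr {v : κ → X} {w : κ → Y}
    (h : ∀ k l, ⟪v k, v l⟫_ℂ = ⟪w k, w l⟫_ℂ) (a b : κ →₀ ℂ) :
    ⟪Finsupp.linearCombination ℂ v a, Finsupp.linearCombination ℂ v b⟫_ℂ =
      ⟪Finsupp.linearCombination ℂ w a, Finsupp.linearCombination ℂ w b⟫_ℂ := by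
  simp only [Finsupp.linearCombination_apply, Finsupp.sum, sum_inner, inner_sum, inner_smul_left,
    inner_smul_right, h]

/-- Total families with the same Gram matrix are carried onto each other by a unitary. -/
theorem exists_linearIsometryEquiv_of_gram_eq [CompleteSpace X] [CompleteSpace Y]
    {v : κ → X} {w : κ → Y} (hv : IsTotal v) (hw : IsTotal w)
    (h : ∀ k l, ⟪v k, v l⟫_ℂ = ⟪w k, w l⟫_ℂ) :
    ∃ e : X ≃ₗᵢ[ℂ] Y, ∀ k, e (v k) = w k := by
  have hn (a : κ →₀ ℂ) : ‖Finsupp.linearCombination ℂ w a‖ = ‖Finsupp.linearCombination ℂ v a‖ :=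
    norm_eq_of_inner_self_eq (inner_linearCombination_congr h a a).symm
  let e := (LinearEquiv.refl ℂ (κ →₀ ℂ)).extend (Finsupp.linearCombination ℂ v)
    (Finsupp.linearCombination ℂ w) hv.denseRange_linearCombination
    ⟨1, fun a => by simp [hn]⟩ hw.denseRange_linearCombination ⟨1, fun a => by simp [hn]⟩
  have he (a : κ →₀ ℂ) :
      e (Finsupp.linearCombination ℂ v a) = Finsupp.linearCombination ℂ w a :=
    LinearEquiv.extend_eq _ _ _ _ _ _ _ _
  refine ⟨⟨e.toLinearEquiv, fun x => ?_⟩, fun k => ?_⟩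
  · change ‖e x‖ = ‖x‖
    induction x using hv.denseRange_linearCombination.induction_on with
    | hp => exact isClosed_eq (by fun_prop) (by fun_prop)
    | ih a => rw [he, hn]
  · change e (v k) = w k
    simpa using he (Finsupp.single k 1)

end Total

/-! ### Direct sums and rows of operators -/

section Direct

variable {κ A B K F G : Type*}

theorem hsum_ext {x y : HSum A B} (h₁ : x.fst = y.fst) (h₂ : x.snd = y.snd) : x = y :=
  WithLp.ofLp_injective 2 (Prod.ext h₁ h₂)

variable [NormedAddCommGroup A] [InnerProductSpace ℂ A]
variable [NormedAddCommGroup B] [InnerProductSpace ℂ B]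
variable [NormedAddCommGroup K] [InnerProductSpace ℂ K]
variable [NormedAddCommGroup F] [InnerProductSpace ℂ F]
variable [NormedAddCommGroup G] [InnerProductSpace ℂ G]

@[simp] theorem inl_apply (a : A) : (inl a : HSum A B) = WithLp.toLp 2 (a, 0) := rfl

@[simp] theorem inr_apply (b : B) : (inr b : HSum A B) = WithLp.toLp 2 (0, b) := rfl

theorem inner_hsum (x y : HSum A B) : ⟪x, y⟫_ℂ = ⟪x.fst, y.fst⟫_ℂ + ⟪x.snd, y.snd⟫_ℂ :=
  WithLp.prod_inner_apply x y

theorem inner_inl_left (a : A) (x : HSum A B) : ⟪inl a, x⟫_ℂ = ⟪a, x.fst⟫_ℂ := by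
  rw [inner_hsum]
  simp

theorem inner_inl_right (x : HSum A B) (a : A) : ⟪x, inl a⟫_ℂ = ⟪x.fst, a⟫_ℂ := by
  rw [inner_hsum]
  simp

theorem inner_inr_left (b : B) (x : HSum A B) : ⟪inr b, x⟫_ℂ = ⟪b, x.snd⟫_ℂ := by
  rw [inner_hsum]
  simp

theorem inner_inr_right (x : HSum A B) (b : B) : ⟪x, inr b⟫_ℂ = ⟪x.snd, b⟫_ℂ := by
  rw [inner_hsum]
  simp

@[simp] theorem inner_single_left (k : κ) (a : K) (x : Copies κ K) :
    ⟪single k a, x⟫_ℂ = ⟪a, x k⟫_ℂ := by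
  classical
  exact lp.inner_single_left (𝕜 := ℂ) k a x

open Classical in
theorem single_coord (k l : κ) (a : K) : (single k a : Copies κ K) l = if k = l then a else 0 := by
  have h : (single k a : Copies κ K) l = Pi.single (M := fun _ => K) k a l := rfl
  rw [h, Pi.single_apply]
  simp only [eq_comm]

theorem isTotal_single : IsTotal fun p : κ × K => (single p.1 p.2 : Copies κ K) := by
  intro x hx
  ext k
  simpa using hx (k, x k)

theorem inner_ofFinsupp (x y : κ →₀ K) :
    ⟪ofFinsupp κ K x, ofFinsupp κ K y⟫_ℂ =
      x.sum fun k a => y.sum fun l b => ⟪(single k a : Copies κ K), single l b⟫_ℂ := by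
  simp only [ofFinsupp, Finsupp.coe_lsum, Finsupp.sum, sum_inner, inner_sum]
  exact Finset.sum_comm

theorem norm_ofFinsupp_sq (x : κ →₀ K) :
    ‖ofFinsupp κ K x‖ ^ 2 = x.sum fun _ a => ‖a‖ ^ 2 := by
  classical
  have h : ((‖ofFinsupp κ K x‖ ^ 2 : ℝ) : ℂ) = ((x.sum fun _ a => ‖a‖ ^ 2 : ℝ) : ℂ) := by
    have := inner_self_eq_norm_sq_to_K (𝕜 := ℂ) (ofFinsupp κ K x)
    push_cast
    rw [← RCLike.ofReal_eq_complex_ofReal, ← this, inner_ofFinsupp]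
    simp only [Finsupp.sum]
    push_cast
    refine Finset.sum_congr rfl fun k hk => ?_
    rw [Finset.sum_eq_single k]
    · rw [inner_single_left, single_coord, if_pos rfl, inner_self_eq_norm_sq_to_K]
    · intro l _ hl
      rw [inner_single_left, single_coord, if_neg hl, inner_zero_right]
    · intro h
      simp [Finsupp.notMem_support_iff.1 h]
  exact_mod_cast h

theorem denseRange_ofFinsupp [CompleteSpace K] : DenseRange (ofFinsupp κ K) := by
  have h : (LinearMap.range (ofFinsupp κ K)).topologicalClosure = ⊤ := by
    rw [Submodule.topologicalClosure_eq_top_iff, Submodule.eq_bot_iff]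
    intro x hx
    refine isTotal_single x fun p => ?_
    refine (Submodule.mem_orthogonal _ _).1 hx _ ⟨Finsupp.single p.1 p.2, ?_⟩
    simp [ofFinsupp]
  exact (Submodule.dense_iff_topologicalClosure_eq_top).2 h

/-- The norm of the row `(x_k) ↦ ∑ T_k x_k` on finitely supported families is at most `1`;
for operators on a single space this is `IsRowContraction`. -/
def IsContractiveRow (T : κ → K →L[ℂ] F) : Prop :=
  ∀ x : κ →₀ K, ‖x.sum fun k a => T k a‖ ^ 2 ≤ x.sum fun _ a => ‖a‖ ^ 2

theorem IsContractiveRow.norm_lsum_le {T : κ → K →L[ℂ] F} (hT : IsContractiveRow T)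
    (x : κ →₀ K) :
    ‖(Finsupp.lsum ℂ fun k => (T k).toLinearMap : (κ →₀ K) →ₗ[ℂ] F) x‖ ≤
      1 * ‖ofFinsupp κ K x‖ := by
  rw [one_mul, ← sq_le_sq₀ (norm_nonneg _) (norm_nonneg _), norm_ofFinsupp_sq]
  exact hT x

theorem IsContractiveRow.norm_row_le [CompleteSpace K] [CompleteSpace F] {T : κ → K →L[ℂ] F}
    (hT : IsContractiveRow T) : ‖row T‖ ≤ 1 :=
  (row T).opNorm_le_bound zero_le_one fun x =>
    LinearMap.norm_extendOfNorm_apply_le denseRange_ofFinsupp 1 hT.norm_lsum_le x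

theorem IsContractiveRow.row_single [CompleteSpace K] [CompleteSpace F] {T : κ → K →L[ℂ] F}
    (hT : IsContractiveRow T) (k : κ) (a : K) : row T (single k a) = T k a := by
  have h := LinearMap.extendOfNorm_eq (denseRange_ofFinsupp (κ := κ) (K := K))
    ⟨1, hT.norm_lsum_le⟩ (Finsupp.single k a)
  rw [Finsupp.lsum_single] at h
  have h' : ofFinsupp κ K (Finsupp.single k a) = single k a := Finsupp.lsum_single ℂ _ k a
  rw [h'] at h
  exact h

/-- A row isometry: the operators `V_k` are isometries with pairwise orthogonal ranges. As the
embeddings of the summands into `⨁_κ K` have just this property, it is stated by comparison with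
them. -/
def IsRowIsometry (V : κ → K →L[ℂ] F) : Prop :=
  ∀ k l a b, ⟪V k a, V l b⟫_ℂ = ⟪(single k a : Copies κ K), single l b⟫_ℂ

theorem IsRowIsometry.inner_self {V : κ → K →L[ℂ] F} (hV : IsRowIsometry V) (k : κ) (a b : K) :
    ⟪V k a, V k b⟫_ℂ = ⟪a, b⟫_ℂ := by
  rw [hV, inner_single_left, single_coord, if_pos rfl]

theorem IsRowIsometry.inner_of_ne {V : κ → K →L[ℂ] F} (hV : IsRowIsometry V) {k l : κ}
    (h : k ≠ l) (a b : K) : ⟪V k a, V l b⟫_ℂ = 0 := by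
  rw [hV, inner_single_left, single_coord, if_neg h.symm, inner_zero_right]

/-- For a row isometry `V`, the inner product of `V_k a` and `V_l b` depends only on `k`, `l` and the
inner product of `a` and `b`. -/
theorem IsRowIsometry.inner_congr {V : κ → K →L[ℂ] F} (hV : IsRowIsometry V)
    {V' : κ → A →L[ℂ] B} (hV' : IsRowIsometry V') (k l : κ) {a b : K} {a' b' : A}
    (h : ⟪a, b⟫_ℂ = ⟪a', b'⟫_ℂ) : ⟪V k a, V l b⟫_ℂ = ⟪V' k a', V' l b'⟫_ℂ := by
  obtain rfl | hkl := eq_or_ne k l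
  · rw [hV.inner_self, hV'.inner_self, h]
  · rw [hV.inner_of_ne hkl, hV'.inner_of_ne hkl]

theorem isRowIsometry_single : IsRowIsometry fun k : κ => (single k : K →L[ℂ] Copies κ K) :=
  fun _ _ _ _ => rfl

theorem isRowIsometry_of_forall {V : κ → K →L[ℂ] F} (h₁ : ∀ k a b, ⟪V k a, V k b⟫_ℂ = ⟪a, b⟫_ℂ)
    (h₂ : ∀ k l, k ≠ l → ∀ a b, ⟪V k a, V l b⟫_ℂ = 0) : IsRowIsometry V := by
  intro k l a b
  rw [inner_single_left, single_coord]
  obtain rfl | hkl := eq_or_ne k l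
  · rw [if_pos rfl, h₁]
  · rw [if_neg hkl.symm, h₂ k l hkl, inner_zero_right]

/-- A row with the Gram matrix of a defect operator is contractive. -/
theorem isContractiveRow_of_inner_eq_sub {T : κ → K →L[ℂ] F} {S : κ → K →L[ℂ] G}
    (h : ∀ k l a b, ⟪T k a, T l b⟫_ℂ =
      ⟪(single k a : Copies κ K), single l b⟫_ℂ - ⟪S k a, S l b⟫_ℂ) : IsContractiveRow T := by
  intro x
  have key : ⟪x.sum fun k a => T k a, x.sum fun k a => T k a⟫_ℂ =
      ⟪ofFinsupp κ K x, ofFinsupp κ K x⟫_ℂ -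
        ⟪x.sum fun k a => S k a, x.sum fun k a => S k a⟫_ℂ := by
    simp only [inner_ofFinsupp, Finsupp.sum, sum_inner, inner_sum, h, Finset.sum_sub_distrib]
    exact congrArg₂ _ Finset.sum_comm rfl
  have := congrArg Complex.re key
  rw [Complex.sub_re, ← RCLike.re_to_complex, ← RCLike.re_to_complex, ← RCLike.re_to_complex,
    inner_self_eq_norm_sq, inner_self_eq_norm_sq, inner_self_eq_norm_sq] at this
  rw [← norm_ofFinsupp_sq, this]
  exact sub_le_self _ (sq_nonneg _)

theorem IsRowIsometry.isContractiveRow {V : κ → K →L[ℂ] F} (hV : IsRowIsometry V) :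
    IsContractiveRow V :=
  isContractiveRow_of_inner_eq_sub (S := fun _ => (0 : K →L[ℂ] K)) fun k l a b => by
    rw [hV]
    simp

theorem IsRowIsometry.row_single [CompleteSpace K] [CompleteSpace F] {V : κ → K →L[ℂ] F}
    (hV : IsRowIsometry V) (k : κ) (a : K) : row V (single k a) = V k a :=
  hV.isContractiveRow.row_single k a

/-- Sesquilinear identities on `⨁_κ K` can be checked on the summands. -/
theorem copies_inner_ext [CompleteSpace K] [CompleteSpace F] [CompleteSpace G]
    {S T : Copies κ K →L[ℂ] F} {S' T' : Copies κ K →L[ℂ] G}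
    (h : ∀ k l a b, ⟪S (single k a), T (single l b)⟫_ℂ = ⟪S' (single k a), T' (single l b)⟫_ℂ)
    (x y : Copies κ K) : ⟪S x, T y⟫_ℂ = ⟪S' x, T' y⟫_ℂ :=
  isTotal_single.inner_ext (fun p q => h p.1 q.1 p.2 q.2) x y

theorem IsRowIsometry.inner_row [CompleteSpace K] [CompleteSpace F] {V : κ → K →L[ℂ] F}
    (hV : IsRowIsometry V) (x y : Copies κ K) : ⟪row V x, row V y⟫_ℂ = ⟪x, y⟫_ℂ :=
  copies_inner_ext (S' := .id ℂ _) (T' := .id ℂ _)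
    (fun k l a b => by rw [hV.row_single, hV.row_single, hV]; rfl) x y

end Direct

/-! ### Defect operators -/

section Defect

variable {A B : Type*}
variable [NormedAddCommGroup A] [InnerProductSpace ℂ A] [CompleteSpace A]
variable [NormedAddCommGroup B] [InnerProductSpace ℂ B] [CompleteSpace B]

theorem one_sub_adjoint_comp_self_nonneg {T : A →L[ℂ] B} (hT : ‖T‖ ≤ 1) :
    0 ≤ (1 : A →L[ℂ] A) - adjoint T ∘L T := by
  rw [ContinuousLinearMap.nonneg_iff_isPositive, ContinuousLinearMap.isPositive_iff_complex]
  intro x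
  have h : ⟪((1 : A →L[ℂ] A) - adjoint T ∘L T) x, x⟫_ℂ = ((‖x‖ ^ 2 - ‖T x‖ ^ 2 : ℝ) : ℂ) := by
    simp [ContinuousLinearMap.adjoint_inner_left, inner_self_eq_norm_sq_to_K]
  rw [h]
  refine ⟨by rw [RCLike.re_to_complex, Complex.ofReal_re], ?_⟩
  have := T.le_of_opNorm_le hT x
  rw [one_mul] at this
  rw [RCLike.re_to_complex, Complex.ofReal_re, sub_nonneg]
  exact pow_le_pow_left₀ (norm_nonneg _) this 2

theorem inner_toDefect {T : A →L[ℂ] B} (hT : ‖T‖ ≤ 1) (x y : A) :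
    ⟪toDefect T x, toDefect T y⟫_ℂ = ⟪x, y⟫_ℂ - ⟪T x, T y⟫_ℂ := by
  have hs : IsSelfAdjoint (defectOp T) := (CFC.sqrt_nonneg _).isSelfAdjoint
  have hm : defectOp T * defectOp T = 1 - adjoint T ∘L T :=
    CFC.sqrt_mul_sqrt_self _ (one_sub_adjoint_comp_self_nonneg hT)
  calc ⟪toDefect T x, toDefect T y⟫_ℂ = ⟪defectOp T x, defectOp T y⟫_ℂ := rfl
    _ = ⟪x, (defectOp T * defectOp T) y⟫_ℂ := by
      have h := ContinuousLinearMap.adjoint_inner_left (defectOp T) (defectOp T y) x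
      rwa [hs.adjoint_eq] at h
    _ = _ := by
      rw [hm]
      simp [ContinuousLinearMap.adjoint_inner_right]

theorem denseRange_toDefect (T : A →L[ℂ] B) : DenseRange (toDefect T) := by
  intro x
  rw [closure_subtype]
  have h : ((↑) '' Set.range (toDefect T) : Set A) = LinearMap.range (defectOp T).toLinearMap := by
    ext y
    simp [toDefect]
  rw [h]
  exact x.2

theorem isTotal_toDefect (T : A →L[ℂ] B) : IsTotal (toDefect T) := by
  intro x hx
  have h : (fun y => ⟪y, x⟫_ℂ) = fun _ => 0 :=
    (denseRange_toDefect T).equalizer (by fun_prop) (by fun_prop) (funext hx)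
  exact inner_self_eq_zero.1 (congrFun h x)

end Defect

/-! ### The defect of a row contraction -/

section RowDefect

variable {ι : Type} {H : Type u} [NormedAddCommGroup H] [InnerProductSpace ℂ H]

theorem IsRowContraction.isContractiveRow {T : ι → H →L[ℂ] H} (hT : IsRowContraction T) :
    IsContractiveRow T := hT

variable [CompleteSpace H]

theorem inner_toDefectSpace_single {T : ι → H →L[ℂ] H} (hT : IsRowContraction T) (i j : ι)
    (x y : H) :
    ⟪toDefectSpace T (single i x), toDefectSpace T (single j y)⟫_ℂ =
      ⟪(single i x : Copies ι H), single j y⟫_ℂ - ⟪T i x, T j y⟫_ℂ := by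
  rw [toDefectSpace, inner_toDefect hT.isContractiveRow.norm_row_le,
    hT.isContractiveRow.row_single, hT.isContractiveRow.row_single]

/-- The vectors `D_T (0, …, x, …, 0)` span a dense subspace of the defect space. -/
theorem isTotal_toDefectSpace_single (T : ι → H →L[ℂ] H) :
    IsTotal fun p : ι × H => toDefectSpace T (single p.1 p.2) := by
  intro δ hδ
  have h : adjoint (toDefectSpace T) δ = 0 := isTotal_single _ fun p => by
    rw [ContinuousLinearMap.adjoint_inner_right]
    exact hδ p
  refine isTotal_toDefect (row T) δ fun x => ?_
  have := congrArg (fun z => ⟪x, z⟫_ℂ) h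
  rwa [ContinuousLinearMap.adjoint_inner_right, inner_zero_right] at this

end RowDefect

/-! ### Creation operators on the Fock space -/

section FockSpace

variable {ι : Type} {𝓛 : Type u} [NormedAddCommGroup 𝓛] [InnerProductSpace ℂ 𝓛]

theorem inner_vacuum_vacuum (a b : 𝓛) : ⟪vacuum ι 𝓛 a, vacuum ι 𝓛 b⟫_ℂ = ⟪a, b⟫_ℂ :=
  isRowIsometry_single.inner_self [] a b

theorem isRowIsometry_single_cons (j : ι) :
    IsRowIsometry fun α : List ι => (single (j :: α) : 𝓛 →L[ℂ] Fock ι 𝓛) :=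
  isRowIsometry_of_forall (fun α a b => isRowIsometry_single.inner_self (j :: α) a b)
    fun _ _ h a b => isRowIsometry_single.inner_of_ne (fun h' => h (List.cons.inj h').2) a b

variable [CompleteSpace 𝓛]

theorem creation_single (j : ι) (α : List ι) (a : 𝓛) :
    creation j (single α a : Fock ι 𝓛) = single (j :: α) a :=
  (isRowIsometry_single_cons j).row_single α a

theorem isRowIsometry_creation : IsRowIsometry fun j : ι => (creation j : _ →L[ℂ] Fock ι 𝓛) := by
  refine isRowIsometry_of_forall (fun j ξ η => (isRowIsometry_single_cons j).inner_row ξ η)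
    fun i j h ξ η => ?_
  have := copies_inner_ext (S := (creation i : _ →L[ℂ] Fock ι 𝓛)) (T := creation j)
    (S' := (0 : _ →L[ℂ] 𝓛)) (T' := 0)
    (fun α β a b => ?_) ξ η
  · simpa using this
  · rw [creation_single, creation_single]
    refine (isRowIsometry_single.inner_of_ne (fun h' => h (List.cons.inj h').1) a b).trans ?_
    simp

theorem inner_creation_vacuum (j : ι) (ξ : Fock ι 𝓛) (a : 𝓛) :
    ⟪creation j ξ, vacuum ι 𝓛 a⟫_ℂ = 0 := by
  have h : adjoint (creation j) (vacuum ι 𝓛 a) = 0 := isTotal_single _ fun p => by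
    rw [ContinuousLinearMap.adjoint_inner_right, creation_single]
    exact isRowIsometry_single.inner_of_ne (List.cons_ne_nil _ _) _ _
  rw [← ContinuousLinearMap.adjoint_inner_right, h, inner_zero_right]

theorem inner_vacuum_creation (j : ι) (ξ : Fock ι 𝓛) (a : 𝓛) :
    ⟪vacuum ι 𝓛 a, creation j ξ⟫_ℂ = 0 := by
  rw [← inner_conj_symm, inner_creation_vacuum, map_zero]

/-- The Wold decomposition of the Fock space: the vacuum vectors and the ranges of the creation
operators together are total. -/
theorem fock_ext {ξ η : Fock ι 𝓛} (h₁ : ∀ a, ⟪vacuum ι 𝓛 a, ξ⟫_ℂ = ⟪vacuum ι 𝓛 a, η⟫_ℂ)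
    (h₂ : ∀ j ζ, ⟪creation j ζ, ξ⟫_ℂ = ⟪creation j ζ, η⟫_ℂ) : ξ = η := by
  refine isTotal_single.ext fun ⟨α, a⟩ => ?_
  cases α with
  | nil => exact h₁ a
  | cons j α => simpa only [creation_single] using h₂ j (single α a)

/-- A vector orthogonal to the ranges of all creation operators is a vacuum vector. -/
theorem vacuum_adjoint_vacuum {ξ : Fock ι 𝓛} (h : ∀ j ζ, ⟪creation j ζ, ξ⟫_ℂ = 0) :
    vacuum ι 𝓛 (adjoint (vacuum ι 𝓛) ξ) = ξ :=
  fock_ext (fun a => by rw [inner_vacuum_vacuum, ContinuousLinearMap.adjoint_inner_right])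
    fun j ζ => by rw [inner_creation_vacuum, h]

end FockSpace

/-! ### Words and the minimal isometric dilation -/

section Dilation

variable {ι : Type} {H : Type u} [NormedAddCommGroup H] [InnerProductSpace ℂ H]

@[simp] theorem word_nil (T : ι → H →L[ℂ] H) (x : H) : word T [] x = x := rfl

@[simp] theorem word_cons (T : ι → H →L[ℂ] H) (j : ι) (α : List ι) (x : H) :
    word T (j :: α) x = T j (word T α x) := by
  simp [word]

@[simp] theorem word_append_singleton (T : ι → H →L[ℂ] H) (α : List ι) (i : ι) (x : H) :
    word T (α ++ [i]) x = word T α (T i x) := by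
  simp [word]

theorem Lifting.fst_word {C : ι → H →L[ℂ] H} (E : Lifting C) (α : List ι)
    (x : HSum H E.HA) : (word E.op α x).fst = word C α x.fst := by
  induction α with
  | nil => rfl
  | cons j α ih => rw [word_cons, word_cons, E.fst_op, ih]

variable [CompleteSpace H]

@[simp] theorem dilation_fst (T : ι → H →L[ℂ] H) (j : ι)
    (x : HSum H (Fock ι (DefectSpace T))) : (dilation T j x).fst = T j x.fst := rfl

@[simp] theorem dilation_snd (T : ι → H →L[ℂ] H) (j : ι)
    (x : HSum H (Fock ι (DefectSpace T))) :
    (dilation T j x).snd =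
      vacuum ι (DefectSpace T) (toDefectSpace T (single j x.fst)) + creation j x.snd := rfl

theorem dilation_inr (T : ι → H →L[ℂ] H) (j : ι) (ξ : Fock ι (DefectSpace T)) :
    dilation T j (inr ξ) = inr (creation j ξ) := by
  refine hsum_ext ?_ ?_
  · exact (dilation_fst T j _).trans (map_zero _)
  · refine (dilation_snd T j _).trans ?_
    simp

theorem isRowIsometry_dilation {T : ι → H →L[ℂ] H} (hT : IsRowContraction T) :
    IsRowIsometry (dilation T) := by
  have key (i j : ι) (x y : HSum H (Fock ι (DefectSpace T))) :
      ⟪dilation T i x, dilation T j y⟫_ℂ =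
        ⟪(single i x.fst : Copies ι H), single j y.fst⟫_ℂ +
          ⟪(creation i x.snd : Fock ι (DefectSpace T)), creation j y.snd⟫_ℂ := by
    rw [inner_hsum, dilation_fst, dilation_fst, dilation_snd, dilation_snd,
      inner_add_left, inner_add_right, inner_add_right, inner_vacuum_creation,
      inner_creation_vacuum, inner_vacuum_vacuum, inner_toDefectSpace_single hT]
    ring
  refine isRowIsometry_of_forall (fun i x y => ?_) fun i j h x y => ?_
  · rw [key, isRowIsometry_single.inner_self, isRowIsometry_creation.inner_self,
      inner_hsum]
  · rw [key, isRowIsometry_single.inner_of_ne h, isRowIsometry_creation.inner_of_ne h, add_zero]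

theorem dilation_word_fst (C : ι → H →L[ℂ] H) (α : List ι) (h : H) :
    (word (dilation C) α (inl h)).fst = word C α h := by
  induction α with
  | nil => rfl
  | cons j α ih => rw [word_cons, word_cons, dilation_fst, ih]

/-- The component of `V^C_α h` in the Fock space `Γ ⊗ 𝓓_C`, for the minimal isometric dilation
`V^C` of `C` and a vector `h` of the space of `C`. -/
def orbit (C : ι → H →L[ℂ] H) (α : List ι) (h : H) : Fock ι (DefectSpace C) :=
  (word (dilation C) α (inl h)).snd

@[simp] theorem orbit_nil (C : ι → H →L[ℂ] H) (h : H) : orbit C [] h = 0 := rfl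

theorem orbit_cons (C : ι → H →L[ℂ] H) (j : ι) (α : List ι) (h : H) :
    orbit C (j :: α) h =
      vacuum ι (DefectSpace C) (toDefectSpace C (single j (word C α h))) +
        creation j (orbit C α h) := by
  rw [orbit, word_cons, dilation_snd, dilation_word_fst]
  rfl

/-- The difference `V_α V_i h - V_α C_i h` is `e_α ⊗ D_C (0, …, h, …, 0)`. -/
theorem single_toDefectSpace_eq_orbit_sub (C : ι → H →L[ℂ] H) (α : List ι) (i : ι) (h : H) :
    (single α (toDefectSpace C (single i h)) : Fock ι (DefectSpace C)) =
      orbit C (α ++ [i]) h - orbit C α (C i h) := by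
  induction α with
  | nil => rw [List.nil_append, orbit_cons]; simp [vacuum]
  | cons j α ih =>
    rw [List.cons_append, orbit_cons, orbit_cons, word_append_singleton, ← creation_single, ih,
      map_sub]
    abel

/-- Minimality of the dilation `V^C`. -/
theorem isTotal_orbit (C : ι → H →L[ℂ] H) :
    IsTotal fun p : List ι × H => orbit C p.1 p.2 := by
  intro ξ hξ
  refine isTotal_single _ fun ⟨α, δ⟩ => ?_
  rw [inner_single_left]
  have h : ξ α = 0 := isTotal_toDefectSpace_single C _ fun ⟨i, x⟩ => by
    rw [← inner_single_left, single_toDefectSpace_eq_orbit_sub, inner_sub_left]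
    exact sub_eq_zero.2 ((hξ (α ++ [i], x)).trans (hξ (α, C i x)).symm)
  rw [h, inner_zero_right]

/-- The empty word contributes nothing to the Fock space components. -/
theorem isTotal_orbit_cons (C : ι → H →L[ℂ] H) :
    IsTotal fun p : ι × List ι × H => orbit C (p.1 :: p.2.1) p.2.2 := by
  intro ξ hξ
  refine isTotal_orbit C _ fun ⟨α, h⟩ => ?_
  cases α with
  | nil => exact inner_zero_left _
  | cons j α => exact hξ (j, α, h)

end Dilation

/-! ### Liftings modelled by multi-analytic operators -/

section Models

variable {ι : Type} {H : Type u} [NormedAddCommGroup H] [InnerProductSpace ℂ H]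

theorem Lifting.isMinimal_iff [CompleteSpace H] {C : ι → H →L[ℂ] H} (E : Lifting C) :
    E.IsMinimal ↔ IsTotal fun p : List ι × H => word E.op p.1 (inl p.2) := by
  rw [isTotal_iff_span_dense, Lifting.IsMinimal]
  have h : {y | ∃ (α : List ι) (h : H), y = word E.op α (inl h)} =
      Set.range fun p : List ι × H => word E.op p.1 (inl p.2) := by
    ext y
    simp [eq_comm]
  rw [h]

variable [CompleteSpace H]

/-- The operator `M : Γ ⊗ 𝓓 → Γ ⊗ 𝓓_C` models the lifting `E` of `C`: there are operators `d_j` from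
the space of `E` into `𝓓` which turn `𝓓` into a copy of the defect space of `E`, with `d_j x` in the
role of `D_E (0, …, x, …, 0)`, such that `⟨V^E_j V^E_β h, e_∅ ⊗ δ⟩ = ⟨d_j E_β h, δ⟩` coincides with
`⟨V^C_j V^C_β h, M (e_∅ ⊗ δ)⟩` for `h` in the space of `C`. -/
structure Models {C : ι → H →L[ℂ] H} (E : Lifting C) (M : FockOperator ι (DefectSpace C))
    (d : ι → HSum H E.HA →L[ℂ] M.D) : Prop where
  gram : ∀ i j x y, ⟪d i x, d j y⟫_ℂ =
    ⟪(single i x : Copies ι (HSum H E.HA)), single j y⟫_ℂ - ⟪E.op i x, E.op j y⟫_ℂ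
  total : IsTotal fun p : ι × HSum H E.HA => d p.1 p.2
  inner_word : ∀ j β h δ, ⟪d j (word E.op β (inl h)), δ⟫_ℂ = ⟪orbit C (j :: β) h, M.symbol δ⟫_ℂ

variable {C : ι → H →L[ℂ] H} {E E' : Lifting C} {M M' : FockOperator ι (DefectSpace C)}

/-- The operators modelling one lifting are equivalent. -/
theorem Models.operator_equivalent {d : ι → HSum H E.HA →L[ℂ] M.D}
    {d' : ι → HSum H E.HA →L[ℂ] M'.D}
    (h : Models E M d) (h' : Models E M' d') : M.Equivalent M' := by
  obtain ⟨v, hv⟩ := exists_linearIsometryEquiv_of_gram_eq h.total h'.total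
    fun p q => by rw [h.gram, h'.gram]
  refine ⟨v, fun δ => (isTotal_orbit_cons C).ext fun ⟨j, β, k⟩ => ?_⟩
  rw [← h.inner_word, ← h'.inner_word, ← hv (j, word E.op β (inl k)), v.inner_map_map]

/-- The operator determines the inner products of the vectors `E_α h`. -/
theorem Models.inner_word_word {d : ι → HSum H E.HA →L[ℂ] M.D}
    {d' : ι → HSum H E'.HA →L[ℂ] M.D}
    (h : Models E M d) (h' : Models E' M d') (α β : List ι) (x y : H) :
    ⟪word E.op α (inl x), word E.op β (inl y)⟫_ℂ =
      ⟪word E'.op α (inl x), word E'.op β (inl y)⟫_ℂ := by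
  have hd (j : ι) (β : List ι) (y : H) :
      d j (word E.op β (inl y)) = d' j (word E'.op β (inl y)) :=
    ext_inner_right ℂ fun δ => by rw [h.inner_word, h'.inner_word]
  induction α generalizing β with
  | nil => rw [word_nil, word_nil, inner_inl_left, inner_inl_left, E.fst_word, E'.fst_word]; rfl
  | cons i α ih =>
    cases β with
    | nil => rw [word_nil, word_nil, inner_inl_right, inner_inl_right, E.fst_word, E'.fst_word]; rfl
    | cons j β =>
      -- By the Gram matrix of the `d_j`, removing the first letters of both words changes the inner
      -- product by terms on which the two liftings agree.
      have g := h.gram i j (word E.op α (inl x)) (word E.op β (inl y))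
      have g' := h'.gram i j (word E'.op α (inl x)) (word E'.op β (inl y))
      rw [hd, hd, g', isRowIsometry_single.inner_congr isRowIsometry_single i j (ih β)] at g
      simpa using g.symm

/-- The minimal liftings modelled by one operator are unitarily equivalent. -/
theorem Models.lifting_equivalent {d : ι → HSum H E.HA →L[ℂ] M.D}
    {d' : ι → HSum H E'.HA →L[ℂ] M.D}
    (h : Models E M d) (h' : Models E' M d') (hE : E.IsMinimal) (hE' : E'.IsMinimal) :
    E.Equivalent E' := by
  rw [Lifting.isMinimal_iff] at hE hE'
  obtain ⟨w, hw⟩ := exists_linearIsometryEquiv_of_gram_eq hE hE'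
    fun p q => h.inner_word_word h' p.1 q.1 p.2 q.2
  refine ⟨w, fun j x => ?_, fun k => hw ([], k)⟩
  induction x using hE.denseRange_linearCombination.induction_on with
  | hp => exact isClosed_eq (by fun_prop) (by fun_prop)
  | ih a =>
    simp only [Finsupp.linearCombination_apply, Finsupp.sum, map_sum, map_smul, hw]
    refine Finset.sum_congr rfl fun p _ => ?_
    have := hw (j :: p.1, p.2)
    rw [word_cons, word_cons] at this
    rw [this]

/-- An operator models all liftings equivalent to one that it models. -/
theorem Models.of_lifting_equivalent {d : ι → HSum H E.HA →L[ℂ] M.D} (h : Models E M d)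
    (e : E.Equivalent E') : ∃ d', Models E' M d' := by
  obtain ⟨w, hw, hw'⟩ := e
  have hs (j : ι) (x : HSum H E'.HA) : w.symm (E'.op j x) = E.op j (w.symm x) := by
    rw [w.symm_apply_eq, hw, w.apply_symm_apply]
  refine ⟨fun j => d j ∘L w.symm.toContinuousLinearEquiv.toContinuousLinearMap,
    fun i j x y => ?_, fun δ hδ => h.total δ fun p => ?_,
    fun j β k δ => ?_⟩
  · change ⟪d i (w.symm x), d j (w.symm y)⟫_ℂ = _
    rw [h.gram, ← hs, ← hs, w.symm.inner_map_map,
      isRowIsometry_single.inner_congr isRowIsometry_single i j (w.symm.inner_map_map x y)]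
  · simpa using hδ (p.1, w p.2)
  · have hk : w.symm (word E'.op β (inl k)) = word E.op β (inl k) := by
      induction β with
      | nil => rw [word_nil, word_nil, w.symm_apply_eq, hw']
      | cons i β ih => rw [word_cons, word_cons, hs, ih]
    change ⟪d j (w.symm _), δ⟫_ℂ = _
    rw [hk, h.inner_word]

/-- A lifting modelled by an operator is modelled by all equivalent operators. -/
theorem Models.of_operator_equivalent {d : ι → HSum H E.HA →L[ℂ] M.D} (h : Models E M d)
    (e : M.Equivalent M') : ∃ d', Models E M' d' := by
  obtain ⟨v, hv⟩ := e
  refine ⟨fun j => v.toContinuousLinearEquiv.toContinuousLinearMap ∘L d j,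
    fun i j x y => ?_, fun δ hδ => ?_, fun j β k δ => ?_⟩
  · change ⟪v (d i x), v (d j y)⟫_ℂ = _
    rw [v.inner_map_map, h.gram]
  · refine v.symm.map_eq_zero_iff.1 (h.total _ fun p => ?_)
    rw [← v.inner_map_map, v.apply_symm_apply]
    exact hδ p
  · obtain ⟨δ, rfl⟩ := v.surjective δ
    change ⟪v (d j _), v δ⟫_ℂ = _
    rw [v.inner_map_map, h.inner_word, hv]

/-- For a minimal lifting the vectors `d_j E_β h` are total, so the symbol is injective. -/
theorem Models.injective_symbol {d : ι → HSum H E.HA →L[ℂ] M.D} (h : Models E M d)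
    (hE : E.IsMinimal) :
    Function.Injective M.symbol := by
  rw [Lifting.isMinimal_iff] at hE
  refine (injective_iff_map_eq_zero _).2 fun δ hδ => h.total δ fun ⟨j, x⟩ => ?_
  have hz : adjoint (d j) δ = 0 := hE _ fun ⟨β, k⟩ => by
    rw [ContinuousLinearMap.adjoint_inner_right, h.inner_word, hδ, inner_zero_right]
  change ⟪d j x, δ⟫_ℂ = 0
  rw [← ContinuousLinearMap.adjoint_inner_right, hz, inner_zero_right]

end Models

/-! ### The operator `𝓜(E)` of a contractive lifting -/

section MapM

variable {ι : Type} {H : Type u} [NormedAddCommGroup H] [InnerProductSpace ℂ H]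
variable {C : ι → H →L[ℂ] H}

theorem Lifting.IsContractive.isRowContraction {E : Lifting C} (hE : E.IsContractive) :
    IsRowContraction E.op := hE

variable [CompleteSpace H] (E : Lifting C)

/-- The operators `h ↦ (V^E_i - C_i) h` on `H`, whose row defines the canonical isometry from `𝓓_C`
onto the wandering subspace. -/
def wanderingRow (i : ι) : H →L[ℂ] HSum (HSum H E.HA) (Fock ι (DefectSpace E.op)) :=
  dilation E.op i ∘L inl ∘L inl - inl ∘L inl ∘L C i

theorem dilation_fst_fst (j : ι) (y : HSum (HSum H E.HA) (Fock ι (DefectSpace E.op))) :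
    (dilation E.op j y).fst.fst = C j y.fst.fst := by
  rw [dilation_fst, E.fst_op]

theorem wanderingRow_apply (i : ι) (x : H) :
    wanderingRow E i x = dilation E.op i (inl (inl x)) - inl (inl (C i x)) := rfl

theorem wanderingRow_fst_fst (i : ι) (x : H) : (wanderingRow E i x).fst.fst = 0 := by
  rw [wanderingRow_apply, WithLp.sub_fst, WithLp.sub_fst, dilation_fst_fst]
  exact sub_self _

theorem inner_inl_inl_left (x : H) (y : HSum (HSum H E.HA) (Fock ι (DefectSpace E.op))) :
    ⟪inl (inl x), y⟫_ℂ = ⟪x, y.fst.fst⟫_ℂ := by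
  rw [inner_inl_left, inner_inl_left]

variable {E}

theorem inner_wanderingRow (hE : E.IsContractive) (i j : ι) (x y : H) :
    ⟪wanderingRow E i x, wanderingRow E j y⟫_ℂ =
      ⟪(single i x : Copies ι H), single j y⟫_ℂ - ⟪C i x, C j y⟫_ℂ := by
  have h₁ : ⟪dilation E.op i (inl (inl x)), dilation E.op j (inl (inl y))⟫_ℂ =
      ⟪(single i x : Copies ι H), single j y⟫_ℂ :=
    (isRowIsometry_dilation hE.isRowContraction).inner_congr isRowIsometry_single i j
      (by rw [inner_inl_inl_left]; rfl)
  have h₂ : ⟪inl (inl (C i x)), wanderingRow E j y⟫_ℂ = 0 := by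
    rw [inner_inl_inl_left, wanderingRow_fst_fst, inner_zero_right]
  have h₃ : ⟪dilation E.op i (inl (inl x)), inl (inl (C j y))⟫_ℂ = ⟪C i x, C j y⟫_ℂ := by
    rw [inner_inl_right, inner_inl_right, dilation_fst_fst]
    rfl
  rw [wanderingRow_apply E i, inner_sub_left, h₂, sub_zero, wanderingRow_apply, inner_sub_right,
    h₁, h₃]

theorem wanderingIsometry_spec (hC : IsRowContraction C) (hE : E.IsContractive) :
    (∀ i x, wanderingIsometry C E (toDefectSpace C (single i x)) = wanderingRow E i x) ∧
      ∀ a b, ⟪wanderingIsometry C E a, wanderingIsometry C E b⟫_ℂ = ⟪a, b⟫_ℂ := by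
  have hr : IsContractiveRow (wanderingRow E) :=
    isContractiveRow_of_inner_eq_sub (inner_wanderingRow hE)
  obtain ⟨h₁, h₂⟩ := extendOfNorm_of_inner_eq (f := row (wanderingRow E))
    (e := toDefectSpace C) (denseRange_toDefect _) <| copies_inner_ext fun i j x y => by
      rw [hr.row_single, hr.row_single, inner_wanderingRow hE, inner_toDefectSpace_single hC]
  exact ⟨fun i x => (h₁ _).trans (hr.row_single i x), h₂⟩

theorem wanderingIsometry_fst_fst (hC : IsRowContraction C) (hE : E.IsContractive)
    (a : DefectSpace C) : (wanderingIsometry C E a).fst.fst = 0 := by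
  have h : fst ∘L fst ∘L wanderingIsometry C E = 0 :=
    (isTotal_toDefectSpace_single C).clm_ext fun ⟨i, x⟩ => by
      change (wanderingIsometry C E (toDefectSpace C (single i x))).fst.fst = 0
      rw [(wanderingIsometry_spec hC hE).1, wanderingRow_fst_fst]
  exact DFunLike.congr_fun h a

/-- The wandering subspace is orthogonal to `V^E_j y` for all `y` orthogonal to `H`. -/
theorem inner_wanderingIsometry_dilation (hC : IsRowContraction C) (hE : E.IsContractive)
    (a : DefectSpace C) (j : ι) {y : HSum (HSum H E.HA) (Fock ι (DefectSpace E.op))}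
    (hy : y.fst.fst = 0) : ⟪wanderingIsometry C E a, dilation E.op j y⟫_ℂ = 0 := by
  have h : adjoint (wanderingIsometry C E) (dilation E.op j y) = 0 :=
    isTotal_toDefectSpace_single C _ fun ⟨i, x⟩ => by
      rw [ContinuousLinearMap.adjoint_inner_right, (wanderingIsometry_spec hC hE).1,
        wanderingRow_apply, inner_sub_left, inner_inl_inl_left, dilation_fst_fst, hy, map_zero,
        inner_zero_right, sub_zero]
      refine ((isRowIsometry_dilation hE.isRowContraction).inner_congr
        (isRowIsometry_single (K := H)) i j (a' := x) (b' := 0) ?_).trans ?_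
      · rw [inner_inl_inl_left, hy]
      · rw [map_zero, inner_zero_right]
  rw [← ContinuousLinearMap.adjoint_inner_right, h, inner_zero_right]

theorem isRowIsometry_word_wanderingIsometry (hC : IsRowContraction C) (hE : E.IsContractive) :
    IsRowIsometry fun α : List ι => word (dilation E.op) α ∘L wanderingIsometry C E := by
  have h₀ (α : List ι) (a : DefectSpace C) :
      (word (dilation E.op) α (wanderingIsometry C E a)).fst.fst = 0 := by
    induction α with
    | nil => exact wanderingIsometry_fst_fst hC hE a
    | cons j α ih => rw [word_cons, dilation_fst_fst, ih, map_zero]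
  intro α β a b
  change ⟪word _ α (wanderingIsometry C E a), word _ β (wanderingIsometry C E b)⟫_ℂ = _
  induction α generalizing β with
  | nil =>
    cases β with
    | nil =>
      rw [isRowIsometry_single.inner_self]
      exact (wanderingIsometry_spec hC hE).2 a b
    | cons j β =>
      rw [word_cons, word_nil, inner_wanderingIsometry_dilation hC hE a j (h₀ β b)]
      exact (isRowIsometry_single.inner_of_ne (List.cons_ne_nil j β).symm a b).symm
  | cons i α ih =>
    cases β with
    | nil =>
      rw [word_cons, word_nil, ← inner_conj_symm,
        inner_wanderingIsometry_dilation hC hE b i (h₀ α a), map_zero]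
      exact (isRowIsometry_single.inner_of_ne (List.cons_ne_nil i α) a b).symm
    | cons j β =>
      rw [word_cons, word_cons, ← creation_single, ← creation_single]
      exact (isRowIsometry_dilation hE.isRowContraction).inner_congr isRowIsometry_creation i j
        (ih β)

theorem shiftIsometry_single (hC : IsRowContraction C) (hE : E.IsContractive) (α : List ι)
    (a : DefectSpace C) :
    shiftIsometry C E (single α a) = word (dilation E.op) α (wanderingIsometry C E a) :=
  (isRowIsometry_word_wanderingIsometry hC hE).row_single α a

theorem shiftIsometry_creation (hC : IsRowContraction C) (hE : E.IsContractive) (j : ι)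
    (ξ : Fock ι (DefectSpace C)) :
    shiftIsometry C E (creation j ξ) = dilation E.op j (shiftIsometry C E ξ) := by
  have h : shiftIsometry C E ∘L creation j = dilation E.op j ∘L shiftIsometry C E :=
    isTotal_single.clm_ext fun ⟨α, a⟩ => by
      rw [ContinuousLinearMap.comp_apply, ContinuousLinearMap.comp_apply, creation_single,
        shiftIsometry_single hC hE, shiftIsometry_single hC hE, word_cons]
  exact DFunLike.congr_fun h ξ

/-- The canonical isometry carries the component of `V^C_α h` in `Γ ⊗ 𝓓_C` to `V^E_α h - C_α h`. -/
theorem shiftIsometry_orbit (hC : IsRowContraction C) (hE : E.IsContractive) (α : List ι)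
    (h : H) :
    shiftIsometry C E (orbit C α h) =
      word (dilation E.op) α (inl (inl h)) - inl (inl (word C α h)) := by
  induction α with
  | nil => rw [orbit_nil, map_zero, word_nil, word_nil, sub_self]
  | cons j α ih =>
    have hv : shiftIsometry C E (vacuum ι (DefectSpace C)
        (toDefectSpace C (single j (word C α h)))) = wanderingRow E j (word C α h) :=
      (shiftIsometry_single hC hE [] _).trans ((wanderingIsometry_spec hC hE).1 _ _)
    rw [orbit_cons, map_add, hv, shiftIsometry_creation hC hE, ih, map_sub, wanderingRow_apply,
      word_cons, word_cons]
    abel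

theorem isContractiveMultiAnalytic_mapM (hC : IsRowContraction C) (hE : E.IsContractive) :
    (mapM C E).IsContractiveMultiAnalytic := by
  refine ⟨fun j => ContinuousLinearMap.ext fun (ξ : Fock ι (DefectSpace E.op)) => ?_,
    ContinuousLinearMap.opNorm_le_bound _ zero_le_one
      fun (ξ : Fock ι (DefectSpace E.op)) => ?_⟩
  · change adjoint (shiftIsometry C E) (inr (creation j ξ)) =
      creation j (adjoint (shiftIsometry C E) (inr ξ))
    refine fock_ext (fun a => ?_) fun i ζ => ?_
    · have hv : shiftIsometry C E (vacuum ι (DefectSpace C) a) = wanderingIsometry C E a :=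
        shiftIsometry_single hC hE [] a
      rw [inner_vacuum_creation, ContinuousLinearMap.adjoint_inner_right, hv, ← dilation_inr]
      exact inner_wanderingIsometry_dilation hC hE a j rfl
    · rw [ContinuousLinearMap.adjoint_inner_right, shiftIsometry_creation hC hE, ← dilation_inr]
      exact (isRowIsometry_dilation hE.isRowContraction).inner_congr isRowIsometry_creation i j
        (ContinuousLinearMap.adjoint_inner_right _ _ _).symm
  · have h₁ : ‖adjoint (shiftIsometry C E)‖ ≤ 1 := by
      rw [LinearIsometryEquiv.norm_map]
      exact (isRowIsometry_word_wanderingIsometry hC hE).isContractiveRow.norm_row_le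
    have h₂ : ‖(inr ξ : HSum (HSum H E.HA) (Fock ι (DefectSpace E.op)))‖ = ‖ξ‖ :=
      norm_eq_of_inner_self_eq (by rw [inner_inr_left]; rfl)
    exact (ContinuousLinearMap.le_of_opNorm_le _ h₁ _).trans_eq (congrArg (1 * ·) h₂)

theorem models_mapM (hC : IsRowContraction C) (hE : E.IsContractive) :
    Models E (mapM C E) fun j => toDefectSpace E.op ∘L single j where
  gram i j x y := inner_toDefectSpace_single hE.isRowContraction i j x y
  total := isTotal_toDefectSpace_single E.op
  inner_word j β h (δ : DefectSpace E.op) := by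
    change ⟪toDefectSpace E.op (single j (word E.op β (inl h))), δ⟫_ℂ =
      ⟪orbit C (j :: β) h, adjoint (shiftIsometry C E) (inr (vacuum ι (DefectSpace E.op) δ))⟫_ℂ
    rw [ContinuousLinearMap.adjoint_inner_right, shiftIsometry_orbit hC hE, inner_inr_right,
      WithLp.sub_snd, word_cons, dilation_snd, dilation_word_fst, inner_sub_left,
      inner_add_left, inner_creation_vacuum, inner_vacuum_vacuum]
    simp

end MapM

/-! ### Isometric dilations whose complement is a shift -/

section ShiftDilation

variable {ι : Type} {X K 𝓓 : Type u}
variable [NormedAddCommGroup X] [InnerProductSpace ℂ X]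
variable [NormedAddCommGroup K] [InnerProductSpace ℂ K] [CompleteSpace K]
variable [NormedAddCommGroup 𝓓] [InnerProductSpace ℂ 𝓓] [CompleteSpace 𝓓]

/-- A row isometry `V` on `K` is an isometric dilation of the tuple `E` on `X`, where `X` is embedded
into `K` by the isometry `S`, and the complement of `X` is invariant under `V` and is identified with
`Γ ⊗ 𝓓` by an isometry `W` which intertwines `V` with the creation operators. -/
structure IsShiftDilation (E : ι → X →L[ℂ] X) (V : ι → K →L[ℂ] K) (S : X →L[ℂ] K)
    (W : Fock ι 𝓓 →L[ℂ] K) : Prop where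
  isRowIsometry : IsRowIsometry V
  inner_S : ∀ x y, ⟪S x, S y⟫_ℂ = ⟪x, y⟫_ℂ
  inner_W : ∀ ξ η, ⟪W ξ, W η⟫_ℂ = ⟪ξ, η⟫_ℂ
  inner_W_S : ∀ ξ x, ⟪W ξ, S x⟫_ℂ = 0
  shift_W : ∀ j ξ, V j (W ξ) = W (creation j ξ)
  shift_S : ∀ j x, V j (S x) = S (E j x) + W (adjoint W (V j (S x)))

/-- The operator `d_j : X → 𝓓` of an isometric dilation with shift complement, characterised by
`V_j x - E_j x = W (e_∅ ⊗ d_j x)` (`IsShiftDilation.shift_S_eq`). -/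
def shiftDefect (V : ι → K →L[ℂ] K) (S : X →L[ℂ] K) (W : Fock ι 𝓓 →L[ℂ] K) (j : ι) :
    X →L[ℂ] 𝓓 :=
  adjoint (vacuum ι 𝓓) ∘L adjoint W ∘L V j ∘L S

namespace IsShiftDilation

variable {E : ι → X →L[ℂ] X} {V : ι → K →L[ℂ] K} {S : X →L[ℂ] K} {W : Fock ι 𝓓 →L[ℂ] K}

theorem inner_S_W (D : IsShiftDilation E V S W) (x : X) (ξ : Fock ι 𝓓) : ⟪S x, W ξ⟫_ℂ = 0 := by
  rw [← inner_conj_symm, D.inner_W_S, map_zero]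

/-- The component of `V_j x` in the complement `W (Γ ⊗ 𝓓)` of `X` is orthogonal to the ranges of
all `V_i W = W L_i`, because `V` is a row isometry, and hence lies in `W (e_∅ ⊗ 𝓓)`. -/
theorem shift_S_eq (D : IsShiftDilation E V S W) (j : ι) (x : X) :
    V j (S x) = S (E j x) + W (vacuum ι 𝓓 (shiftDefect V S W j x)) := by
  have hv : vacuum ι 𝓓 (shiftDefect V S W j x) = adjoint W (V j (S x)) := by
    refine vacuum_adjoint_vacuum fun i ζ => ?_
    change ⟪creation i ζ, adjoint W (V j (S x))⟫_ℂ = 0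
    rw [ContinuousLinearMap.adjoint_inner_right, ← D.shift_W]
    refine (D.isRowIsometry.inner_congr (isRowIsometry_single (K := X)) i j
      (a' := 0) (b' := 0) ?_).trans ?_
    · rw [D.inner_W_S, inner_zero_left]
    · rw [map_zero, map_zero, inner_zero_left]
  rw [hv]
  exact D.shift_S j x

theorem inner_shiftDefect (D : IsShiftDilation E V S W) (i j : ι) (x y : X) :
    ⟪shiftDefect V S W i x, shiftDefect V S W j y⟫_ℂ =
      ⟪(single i x : Copies ι X), single j y⟫_ℂ - ⟪E i x, E j y⟫_ℂ := by
  rw [← D.isRowIsometry.inner_congr isRowIsometry_single i j (D.inner_S x y), D.shift_S_eq,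
    D.shift_S_eq, inner_add_left, inner_add_right, inner_add_right, D.inner_S_W, D.inner_W_S,
    D.inner_S, D.inner_W, inner_vacuum_vacuum]
  ring

theorem isRowContraction (D : IsShiftDilation E V S W) : IsRowContraction E :=
  isContractiveRow_of_inner_eq_sub (S := shiftDefect V S W) fun i j x y => by
    rw [D.inner_shiftDefect, sub_sub_cancel]

/-- As the complement of `X` is invariant, `V_α x` and `E_α x` differ by an element of it. -/
theorem exists_word_eq (D : IsShiftDilation E V S W) (α : List ι) (x : X) :
    ∃ ζ, word V α (S x) = S (word E α x) + W ζ := by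
  induction α with
  | nil => exact ⟨0, by simp⟩
  | cons j α ih =>
    obtain ⟨ζ, hζ⟩ := ih
    refine ⟨vacuum ι 𝓓 (shiftDefect V S W j (word E α x)) + creation j ζ, ?_⟩
    rw [word_cons, word_cons, hζ, map_add, D.shift_S_eq, D.shift_W, map_add, add_assoc]

theorem inner_word_S (D : IsShiftDilation E V S W) (α : List ι) (x y : X) :
    ⟪word V α (S x), S y⟫_ℂ = ⟪word E α x, y⟫_ℂ := by
  obtain ⟨ζ, hζ⟩ := D.exists_word_eq α x
  rw [hζ, inner_add_left, D.inner_W_S, D.inner_S, add_zero]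

theorem inner_word_W_vacuum (D : IsShiftDilation E V S W) (j : ι) (β : List ι) (x : X) (δ : 𝓓) :
    ⟪word V (j :: β) (S x), W (vacuum ι 𝓓 δ)⟫_ℂ = ⟪shiftDefect V S W j (word E β x), δ⟫_ℂ := by
  obtain ⟨ζ, hζ⟩ := D.exists_word_eq β x
  rw [word_cons, hζ, map_add, D.shift_S_eq, D.shift_W, inner_add_left, inner_add_left, D.inner_S_W,
    D.inner_W, D.inner_W, inner_vacuum_vacuum, inner_creation_vacuum, zero_add, add_zero]

end IsShiftDilation

end ShiftDilation

/-- For an isometry `W : F → K`, the complement in `H ⊕ K` of `H ⊕ (K ⊖ ran W)` is `ran W`. -/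
theorem hsum_eq_orthogonalProjectionOnto_add {H F K : Type*}
    [NormedAddCommGroup H] [InnerProductSpace ℂ H] [CompleteSpace H]
    [NormedAddCommGroup F] [InnerProductSpace ℂ F] [CompleteSpace F]
    [NormedAddCommGroup K] [InnerProductSpace ℂ K] [CompleteSpace K] {W : F →L[ℂ] K}
    [(LinearMap.range W.toLinearMap)ᗮ.HasOrthogonalProjection]
    (hW : ∀ ξ η, ⟪W ξ, W η⟫_ℂ = ⟪ξ, η⟫_ℂ) (z : HSum H K) :
    z = WithLp.toLp 2 (z.fst,
        ((LinearMap.range W.toLinearMap)ᗮ.orthogonalProjectionOnto z.snd : K)) +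
      (inr ∘L W : F →L[ℂ] HSum H K) (adjoint (inr ∘L W : F →L[ℂ] HSum H K) z) := by
  have ha : adjoint (inr ∘L W : F →L[ℂ] HSum H K) z = adjoint W z.snd :=
    ext_inner_left ℂ fun ξ => by
      rw [ContinuousLinearMap.adjoint_inner_right, ContinuousLinearMap.adjoint_inner_right]
      exact inner_inr_left _ _
  have hp : ((LinearMap.range W.toLinearMap)ᗮ.orthogonalProjectionOnto z.snd : K) =
      z.snd - W (adjoint W z.snd) := by
    refine Submodule.eq_starProjection_of_mem_of_inner_eq_zero ?_ fun w hw => ?_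
    · rintro _ ⟨ξ, rfl⟩
      change ⟪W ξ, _⟫_ℂ = 0
      rw [inner_sub_right, hW, ContinuousLinearMap.adjoint_inner_right, sub_self]
    · rw [sub_sub_cancel]
      exact hw _ ⟨_, rfl⟩
  rw [ha, hp]
  exact hsum_ext (add_zero _).symm (sub_add_cancel _ _).symm

/-! ### The lifting `𝓔(M)` of a contractive multi-analytic operator -/

section Model

variable {ι : Type} {𝓛 : Type u} [NormedAddCommGroup 𝓛] [InnerProductSpace ℂ 𝓛] [CompleteSpace 𝓛]
variable {M : FockOperator ι 𝓛}

theorem FockOperator.IsContractiveMultiAnalytic.op_creation (hM : M.IsContractiveMultiAnalytic)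
    (j : ι) (ξ : Fock ι M.D) : M.op (creation j ξ) = creation j (M.op ξ) :=
  DFunLike.congr_fun (hM.1 j) ξ

theorem inner_modelIsometry (hM : ‖M.op‖ ≤ 1) (ξ η : Fock ι M.D) :
    ⟪modelIsometry M ξ, modelIsometry M η⟫_ℂ = ⟪ξ, η⟫_ℂ := by
  rw [inner_hsum]
  change ⟪M.op ξ, M.op η⟫_ℂ + ⟪toDefect M.op ξ, toDefect M.op η⟫_ℂ = _
  rw [inner_toDefect hM, add_sub_cancel]

theorem inner_toDefect_creation (hM : M.IsContractiveMultiAnalytic) (i j : ι)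
    (ξ η : Fock ι M.D) :
    ⟪toDefect M.op (creation i ξ), toDefect M.op (creation j η)⟫_ℂ =
      ⟪(creation i ξ : Fock ι M.D), creation j η⟫_ℂ -
        ⟪creation i (M.op ξ), creation j (M.op η)⟫_ℂ := by
  rw [inner_toDefect hM.2, hM.op_creation, hM.op_creation]

theorem residualShift_spec (hM : M.IsContractiveMultiAnalytic) (j : ι) :
    (∀ ξ, residualShift M j (toDefect M.op ξ) = toDefect M.op (creation j ξ)) ∧
      ∀ a b, ⟪residualShift M j a, residualShift M j b⟫_ℂ = ⟪a, b⟫_ℂ :=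
  extendOfNorm_of_inner_eq (f := toDefect M.op ∘L creation j) (denseRange_toDefect M.op)
    fun ξ η => (inner_toDefect_creation hM j j ξ η).trans <| by
      rw [isRowIsometry_creation.inner_self, isRowIsometry_creation.inner_self,
        inner_toDefect hM.2]

theorem isRowIsometry_residualShift (hM : M.IsContractiveMultiAnalytic) :
    IsRowIsometry (residualShift M) := by
  refine isRowIsometry_of_forall (fun j => (residualShift_spec hM j).2) fun i j h a b => ?_
  have := (isTotal_toDefect M.op).inner_ext (S := residualShift M i) (T := residualShift M j)
    (S' := (0 : _ →L[ℂ] 𝓛)) (T' := 0) (fun ξ η => ?_) a b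
  · simpa using this
  · rw [(residualShift_spec hM i).1, (residualShift_spec hM j).1, inner_toDefect_creation hM,
      isRowIsometry_creation.inner_of_ne h, isRowIsometry_creation.inner_of_ne h]
    simp

theorem modelShift_fst (j : ι) (x : ModelSpace M) :
    (modelShift M j x).fst = creation j x.fst := rfl

theorem modelShift_snd (j : ι) (x : ModelSpace M) :
    (modelShift M j x).snd = residualShift M j x.snd := rfl

theorem modelShift_inl (j : ι) (ξ : Fock ι 𝓛) :
    modelShift M j (inl ξ) = inl (creation j ξ) :=
  hsum_ext rfl (map_zero (residualShift M j))

theorem isRowIsometry_modelShift (hM : M.IsContractiveMultiAnalytic) :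
    IsRowIsometry (modelShift M) := by
  refine isRowIsometry_of_forall (fun j x y => ?_) fun i j h x y => ?_
  · rw [inner_hsum, modelShift_fst, modelShift_fst, modelShift_snd, modelShift_snd,
      isRowIsometry_creation.inner_self, (isRowIsometry_residualShift hM).inner_self, inner_hsum]
  · rw [inner_hsum, modelShift_fst, modelShift_fst, modelShift_snd, modelShift_snd,
      isRowIsometry_creation.inner_of_ne h, (isRowIsometry_residualShift hM).inner_of_ne h,
      add_zero]

theorem modelShift_modelIsometry (hM : M.IsContractiveMultiAnalytic) (j : ι) (ξ : Fock ι M.D) :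
    modelShift M j (modelIsometry M ξ) = modelIsometry M (creation j ξ) :=
  hsum_ext (hM.op_creation j ξ).symm ((residualShift_spec hM j).1 ξ)

theorem inner_modelIsometry_modelHA (ξ : Fock ι M.D) (a : modelHA M) :
    ⟪modelIsometry M ξ, a⟫_ℂ = 0 := a.2 _ ⟨ξ, rfl⟩

/-- A vector of `H_A` is determined by its component in `Γ ⊗ 𝓛`. -/
theorem modelHA_eq_zero_of_fst_eq_zero {a : modelHA M} (h : (a : ModelSpace M).fst = 0) : a = 0 := by
  refine Subtype.ext (hsum_ext h (isTotal_toDefect M.op _ fun ξ => ?_))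
  have h' : ⟪M.op ξ, (a : ModelSpace M).fst⟫_ℂ +
      ⟪toDefect M.op ξ, (a : ModelSpace M).snd⟫_ℂ = 0 :=
    (inner_hsum _ _).symm.trans (inner_modelIsometry_modelHA ξ a)
  rwa [h, inner_zero_right, zero_add] at h'

end Model

section MapE

variable {ι : Type} {H : Type u} [NormedAddCommGroup H] [InnerProductSpace ℂ H] [CompleteSpace H]
variable {C : ι → H →L[ℂ] H} {M : FockOperator ι (DefectSpace C)}

/-- A row isometry on `K` is extended to `H ⊕ K` by means of an isometric copy of the defect space
of `C` orthogonal to its ranges. -/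
theorem isRowIsometry_extension {K : Type*} [NormedAddCommGroup K] [InnerProductSpace ℂ K]
    (hC : IsRowContraction C) {V : ι → K →L[ℂ] K} (hV : IsRowIsometry V)
    {J : DefectSpace C →L[ℂ] K} (hJ : ∀ a b, ⟪J a, J b⟫_ℂ = ⟪a, b⟫_ℂ)
    (hVJ : ∀ j a z, ⟪J a, V j z⟫_ℂ = 0) :
    IsRowIsometry fun j : ι => (pair (C j ∘L fst)
      (J ∘L toDefectSpace C ∘L single j ∘L fst + V j ∘L snd) : HSum H K →L[ℂ] HSum H K) := by
  have hVJ' (j : ι) (a : DefectSpace C) (z : K) : ⟪V j z, J a⟫_ℂ = 0 := by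
    rw [← inner_conj_symm, hVJ, map_zero]
  intro i j x y
  rw [inner_hsum]
  change ⟪C i x.fst, C j y.fst⟫_ℂ + ⟪J (toDefectSpace C (single i x.fst)) + V i x.snd,
    J (toDefectSpace C (single j y.fst)) + V j y.snd⟫_ℂ = _
  rw [inner_add_left, inner_add_right, inner_add_right, hVJ, hVJ', hJ,
    inner_toDefectSpace_single hC]
  obtain rfl | h := eq_or_ne i j
  · rw [hV.inner_self, isRowIsometry_single.inner_self, isRowIsometry_single.inner_self,
      inner_hsum]
    ring
  · rw [hV.inner_of_ne h, isRowIsometry_single.inner_of_ne h, isRowIsometry_single.inner_of_ne h]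
    ring

theorem isRowIsometry_bigShift (hC : IsRowContraction C) (hM : M.IsContractiveMultiAnalytic) :
    IsRowIsometry (bigShift C M) :=
  isRowIsometry_extension hC (isRowIsometry_modelShift hM)
    (J := inl ∘L vacuum ι (DefectSpace C))
    (fun a b => (inner_inl_left _ _).trans (inner_vacuum_vacuum a b))
    fun j a z => (inner_inl_left _ _).trans (inner_vacuum_creation j z.fst a)

theorem bigShift_inr_modelIsometry (hM : M.IsContractiveMultiAnalytic) (j : ι)
    (ξ : Fock ι M.D) :
    bigShift C M j (inr (modelIsometry M ξ)) = inr (modelIsometry M (creation j ξ)) := by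
  have h₀ : (inl ∘L vacuum ι (DefectSpace C) ∘L toDefectSpace C ∘L single j :
      H →L[ℂ] ModelSpace M) 0 = 0 := map_zero _
  exact hsum_ext (map_zero (C j)) <|
    (congrArg₂ (· + ·) h₀ (modelShift_modelIsometry hM j ξ)).trans (zero_add _)

theorem bigShift_word_inl (α : List ι) (h : H) :
    word (bigShift C M) α (inl h) = WithLp.toLp 2 (word C α h, inl (orbit C α h)) := by
  induction α with
  | nil => rfl
  | cons j α ih =>
    have h₁ : modelShift M j (inl (orbit C α h)) = inl (creation j (orbit C α h)) :=
      modelShift_inl j _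
    have h₂ : (inl (orbit C (j :: α) h) : ModelSpace M) =
        inl (vacuum ι (DefectSpace C) (toDefectSpace C (single j (word C α h)))) +
          inl (creation j (orbit C α h)) :=
      (congrArg inl (orbit_cons C j α h)).trans (map_add inl _ _)
    rw [word_cons, ih]
    exact hsum_ext (word_cons C j α h).symm ((congrArg (_ + ·) h₁).trans h₂.symm)

variable (M)

/-- The inclusion of `H ⊕ H_A` into `H ⊕ H_Θ`. -/
def modelInclusion : HSum H (mapE C M).HA →L[ℂ] HSum H (ModelSpace M) :=
  pair fst ((modelHA M).subtypeL ∘L snd)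

variable {M}

theorem isShiftDilation_mapE (hC : IsRowContraction C) (hM : M.IsContractiveMultiAnalytic) :
    IsShiftDilation (mapE C M).op (bigShift C M) (modelInclusion M)
      (inr ∘L modelIsometry M) where
  isRowIsometry := isRowIsometry_bigShift hC hM
  inner_S x y := (inner_hsum _ _).trans (inner_hsum x y).symm
  inner_W ξ η := (inner_inr_left _ _).trans (inner_modelIsometry hM.2 ξ η)
  inner_W_S ξ x := (inner_inr_left _ _).trans (inner_modelIsometry_modelHA ξ x.snd)
  shift_W j ξ := bigShift_inr_modelIsometry hM j ξ
  shift_S j x := hsum_eq_orthogonalProjectionOnto_add (inner_modelIsometry hM.2)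
    (bigShift C M j (modelInclusion M x))

theorem isContractive_mapE (hC : IsRowContraction C) (hM : M.IsContractiveMultiAnalytic) :
    (mapE C M).IsContractive :=
  (isShiftDilation_mapE hC hM).isRowContraction

theorem isMinimal_mapE (hC : IsRowContraction C) (hM : M.IsContractiveMultiAnalytic) :
    (mapE C M).IsMinimal := by
  rw [Lifting.isMinimal_iff]
  intro (x : HSum H (modelHA M)) hx
  have hx' (α : List ι) (h : H) :
      ⟪word C α h, x.fst⟫_ℂ + ⟪orbit C α h, (x.snd : ModelSpace M).fst⟫_ℂ = 0 := by
    have h₀ : ⟪word (bigShift C M) α (inl h), modelInclusion M x⟫_ℂ = 0 :=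
      ((isShiftDilation_mapE hC hM).inner_word_S α (inl h) x).trans (hx (α, h))
    rw [bigShift_word_inl, inner_hsum] at h₀
    exact (congrArg (_ + ·) (inner_inl_left _ _).symm).trans h₀
  have h₁ : x.fst = 0 := (inner_self_eq_zero (𝕜 := ℂ)).1 <| by simpa using hx' [] x.fst
  have h₂ : (x.snd : ModelSpace M).fst = 0 := isTotal_orbit C _ fun p => by
    simpa [h₁] using hx' p.1 p.2
  exact hsum_ext h₁ (modelHA_eq_zero_of_fst_eq_zero h₂)

theorem models_mapE (hC : IsRowContraction C) (hM : M.IsContractiveMultiAnalytic)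
    (hinj : Function.Injective M.symbol) :
    Models (mapE C M) M
      (shiftDefect (bigShift C M) (modelInclusion M) (inr ∘L modelIsometry M)) := by
  have D := isShiftDilation_mapE hC hM
  have hw (j : ι) (β : List ι) (h : H) (δ : M.D) :
      ⟪shiftDefect (bigShift C M) (modelInclusion M) (inr ∘L modelIsometry M) j
        (word (mapE C M).op β (inl h)), δ⟫_ℂ = ⟪orbit C (j :: β) h, M.symbol δ⟫_ℂ := by
    have h₀ : word (bigShift C M) (j :: β) (modelInclusion M (inl h)) =
      WithLp.toLp 2 (word C (j :: β) h, inl (orbit C (j :: β) h)) := bigShift_word_inl _ h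
    have h₁ := D.inner_word_W_vacuum j β (inl h) δ
    rw [h₀] at h₁
    exact h₁.symm.trans ((inner_inr_right _ _).trans (inner_inl_left _ _))
  refine ⟨D.inner_shiftDefect, fun δ hδ => ?_, hw⟩
  -- A vector `δ` orthogonal to all `d_j x` is in the kernel of the symbol.
  refine (injective_iff_map_eq_zero _).1 hinj δ ((isTotal_orbit_cons C) _ fun ⟨j, β, h⟩ => ?_)
  exact (hw j β h δ).symm.trans (hδ (j, _))

end MapE

/-! ### The correspondence of equivalence classes -/

theorem hilbertDim_congr {K K' : Type u} [NormedAddCommGroup K] [InnerProductSpace ℂ K]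
    [NormedAddCommGroup K'] [InnerProductSpace ℂ K'] (e : K ≃ₗᵢ[ℂ] K') :
    hilbertDim K = hilbertDim K' := by
  have h (κ : Type u) : Nonempty (HilbertBasis κ ℂ K) ↔ Nonempty (HilbertBasis κ ℂ K') :=
    ⟨fun ⟨b⟩ => ⟨⟨e.symm.trans b.repr⟩⟩, fun ⟨b⟩ => ⟨⟨e.trans b.repr⟩⟩⟩
  refine congrArg sInf (Set.ext fun c => exists_congr fun κ => ?_)
  rw [exists_const_iff, exists_const_iff, h κ]

section Correspondence

variable {ι : Type} {H : Type u} [NormedAddCommGroup H] [InnerProductSpace ℂ H] [CompleteSpace H]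
variable {C : ι → H →L[ℂ] H}

theorem injective_symbol_mapM (hC : IsRowContraction C) {E : Lifting C} (hE : E.IsContractive)
    (hE' : E.IsMinimal) : Function.Injective (mapM C E).symbol :=
  (models_mapM hC hE).injective_symbol hE'

theorem mapE_mapM_equivalent (hC : IsRowContraction C) {E : Lifting C} (hE : E.IsContractive)
    (hE' : E.IsMinimal) : (mapE C (mapM C E)).Equivalent E :=
  have hM := isContractiveMultiAnalytic_mapM hC hE
  (models_mapE hC hM (injective_symbol_mapM hC hE hE')).lifting_equivalent
    (models_mapM hC hE) (isMinimal_mapE hC hM) hE'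

theorem mapM_mapE_equivalent (hC : IsRowContraction C) {M : FockOperator ι (DefectSpace C)}
    (hM : M.IsContractiveMultiAnalytic) (hM' : Function.Injective M.symbol) :
    (mapM C (mapE C M)).Equivalent M :=
  (models_mapM hC (isContractive_mapE hC hM)).operator_equivalent (models_mapE hC hM hM')

theorem mapM_congr (hC : IsRowContraction C) {E E' : Lifting C} (hE : E.IsContractive)
    (hE' : E'.IsContractive) (h : E.Equivalent E') : (mapM C E).Equivalent (mapM C E') := by
  obtain ⟨_, hd⟩ := (models_mapM hC hE).of_lifting_equivalent h
  exact hd.operator_equivalent (models_mapM hC hE')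

theorem mapE_congr (hC : IsRowContraction C) {M M' : FockOperator ι (DefectSpace C)}
    (hM : M.IsContractiveMultiAnalytic) (hinj : Function.Injective M.symbol)
    (hM' : M'.IsContractiveMultiAnalytic) (hinj' : Function.Injective M'.symbol)
    (h : M.Equivalent M') : (mapE C M).Equivalent (mapE C M') := by
  obtain ⟨_, hd⟩ := (models_mapE hC hM hinj).of_operator_equivalent h
  exact hd.lifting_equivalent (models_mapE hC hM' hinj') (isMinimal_mapE hC hM)
    (isMinimal_mapE hC hM')

/-- The map `𝓜` from minimal contractive liftings to injective symbols. -/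
def liftingToSymbol (hC : IsRowContraction C) (E : MinimalContractiveLifting C) :
    InjectiveSymbol ι (DefectSpace C) :=
  ⟨mapM C E.1, isContractiveMultiAnalytic_mapM hC E.2.1, injective_symbol_mapM hC E.2.1 E.2.2⟩

/-- The map `𝓔` from injective symbols to minimal contractive liftings. -/
def symbolToLifting (hC : IsRowContraction C) (M : InjectiveSymbol ι (DefectSpace C)) :
    MinimalContractiveLifting C :=
  ⟨mapE C M.1, isContractive_mapE hC M.2.1, isMinimal_mapE hC M.2.1⟩

theorem liftingToSymbol_val (hC : IsRowContraction C) (E : MinimalContractiveLifting C) :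
    (liftingToSymbol hC E).1 = mapM C E.1 := rfl

theorem symbolToLifting_val (hC : IsRowContraction C) (M : InjectiveSymbol ι (DefectSpace C)) :
    (symbolToLifting hC M).1 = mapE C M.1 := rfl

/-- The map of equivalence classes induced by `𝓜`. -/
def liftingClassToSymbolClass (hC : IsRowContraction C) :
    Quotient (liftingSetoid C) → Quotient (symbolSetoid ι (DefectSpace C)) :=
  Quotient.map (liftingToSymbol hC) fun E E' h => mapM_congr hC E.2.1 E'.2.1 h

/-- The map of equivalence classes induced by `𝓔`. -/
def symbolClassToLiftingClass (hC : IsRowContraction C) :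
    Quotient (symbolSetoid ι (DefectSpace C)) → Quotient (liftingSetoid C) :=
  Quotient.map (symbolToLifting hC)
    fun M M' h => mapE_congr hC M.2.1 M.2.2 M'.2.1 M'.2.2 h

theorem liftingClassToSymbolClass_mk (hC : IsRowContraction C) (E : MinimalContractiveLifting C) :
    liftingClassToSymbolClass hC (Quotient.mk _ E) = Quotient.mk _ (liftingToSymbol hC E) := rfl

theorem symbolClassToLiftingClass_mk (hC : IsRowContraction C)
    (M : InjectiveSymbol ι (DefectSpace C)) :
    symbolClassToLiftingClass hC (Quotient.mk _ M) = Quotient.mk _ (symbolToLifting hC M) := rfl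

theorem symbolToLifting_liftingToSymbol (hC : IsRowContraction C)
    (E : MinimalContractiveLifting C) :
    (liftingSetoid C).r (symbolToLifting hC (liftingToSymbol hC E)) E := by
  change (symbolToLifting hC (liftingToSymbol hC E)).1.Equivalent E.1
  -- Rewriting keeps the unifier from unfolding both constructions.
  rw [symbolToLifting_val, liftingToSymbol_val]
  exact mapE_mapM_equivalent hC E.2.1 E.2.2

theorem liftingToSymbol_symbolToLifting (hC : IsRowContraction C)
    (M : InjectiveSymbol ι (DefectSpace C)) :
    (symbolSetoid ι (DefectSpace C)).r (liftingToSymbol hC (symbolToLifting hC M)) M := by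
  change (liftingToSymbol hC (symbolToLifting hC M)).1.Equivalent M.1
  rw [liftingToSymbol_val, symbolToLifting_val]
  exact mapM_mapE_equivalent hC M.2.1 M.2.2

/-- The bijection between equivalence classes induced by `𝓜` and `𝓔`. -/
def correspondence (hC : IsRowContraction C) :
    Quotient (liftingSetoid C) ≃ Quotient (symbolSetoid ι (DefectSpace C)) where
  toFun := liftingClassToSymbolClass hC
  invFun := symbolClassToLiftingClass hC
  left_inv := Quotient.ind fun E => by
    rw [liftingClassToSymbolClass_mk, symbolClassToLiftingClass_mk]
    exact Quotient.sound (symbolToLifting_liftingToSymbol hC E)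
  right_inv := Quotient.ind fun M => by
    rw [symbolClassToLiftingClass_mk, liftingClassToSymbolClass_mk]
    exact Quotient.sound (liftingToSymbol_symbolToLifting hC M)

end Correspondence

end RowLifting

end

theorem theorem3p2 {ι : Type} {H : Type u} [NormedAddCommGroup H] [InnerProductSpace ℂ H]
    [CompleteSpace H] (C : ι → H →L[ℂ] H) (hC : RowLifting.IsRowContraction C) :
    -- `𝓔` maps contractive multi-analytic operators to contractive liftings of `C`
    (∀ M : RowLifting.FockOperator ι (RowLifting.DefectSpace C),
      M.IsContractiveMultiAnalytic → (RowLifting.mapE C M).IsContractive) ∧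
    -- `𝓜` maps contractive liftings of `C` to contractive multi-analytic operators
    (∀ E : RowLifting.Lifting C,
      E.IsContractive → (RowLifting.mapM C E).IsContractiveMultiAnalytic) ∧
    -- `𝓜` and `𝓔` induce mutually inverse bijections of the equivalence classes
    ∃ Φ : Quotient (RowLifting.liftingSetoid C) ≃
        Quotient (RowLifting.symbolSetoid ι (RowLifting.DefectSpace C)),
      (∀ E : RowLifting.MinimalContractiveLifting C,
        ∃ h : (RowLifting.mapM C E.1).IsContractiveMultiAnalytic ∧
            Function.Injective (RowLifting.mapM C E.1).symbol,
          Φ (Quotient.mk _ E) = Quotient.mk _ ⟨RowLifting.mapM C E.1, h⟩) ∧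
      (∀ M : RowLifting.InjectiveSymbol ι (RowLifting.DefectSpace C),
        ∃ h : (RowLifting.mapE C M.1).IsContractive ∧ (RowLifting.mapE C M.1).IsMinimal,
          Φ.symm (Quotient.mk _ M) = Quotient.mk _ ⟨RowLifting.mapE C M.1, h⟩) ∧
      -- the dimension of `𝓓` is the defect of `E`
      (∀ (E : RowLifting.MinimalContractiveLifting C)
        (M : RowLifting.InjectiveSymbol ι (RowLifting.DefectSpace C)),
        Φ (Quotient.mk _ E) = Quotient.mk _ M →
          RowLifting.hilbertDim M.1.D = RowLifting.hilbertDim (RowLifting.DefectSpace E.1.op)) :=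
  ⟨fun _ hM => RowLifting.isContractive_mapE hC hM,
    fun _ hE => RowLifting.isContractiveMultiAnalytic_mapM hC hE,
    RowLifting.correspondence hC,
    fun E => ⟨(RowLifting.liftingToSymbol hC E).2, rfl⟩,
    fun M => ⟨(RowLifting.symbolToLifting hC M).2, rfl⟩,
    fun E M h => by
      obtain ⟨v, -⟩ : (RowLifting.mapM C E.1).Equivalent M.1 := Quotient.exact h
      exact (RowLifting.hilbertDim_congr v).symm⟩
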